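/- Let $X$ be a finite group, $G\subset X$ a subgroup, and $M\subset X$ a set of left coset representatives with $e\in M$: every $x\in X$ factors uniquely as $x=us$ with $u\in G$, $s\in M$. For $s,t\in M$ and $u\in G$ define $\tau(s,t),\ s\triangleright u\in G$ and $s\cdot t,\ s\triangleleft u\in M$ by the unique factorisations $st=\tau(s,t)(s\cdot t)$ and $su=(s\triangleright u)(s\triangleleft u)$. Let $k$ be a field. Let $\mathcal D$ be the category whose objects are finite dimensional $k$-vector spaces $V$ with a decomposition $V=\bigoplus_{s\in M,\,u\in G}V_{s,u}$ (for $\xi\in V_{s,u}$ write $\langle\xi\rangle=s$, $|\xi|=u$), a linear right action $\bar\triangleleft$ of $G$, and linear maps $t\,\bar\triangleright:V\to V$ for $t\in M$, such that for all homogeneous $\eta,\kappa$ and all $s,t,p\in M$, $u\in G$: 1. $\langle\eta\bar\triangleleft u\rangle=\langle\eta\rangle\triangleleft u$ and $|\eta\bar\triangleleft u|=(\langle\eta\rangle\triangleright u)^{-1}|\eta|u$; 2. $s\bar\triangleright\eta$ is homogeneous, with $s\cdot\langle\eta\rangle=\langle s\bar\triangleright\eta\rangle\cdot(s\triangleleft|\eta|)$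 and $\tau(s,\langle\eta\rangle)^{-1}(s\triangleright|\eta|)=\tau(\langle s\bar\triangleright\eta\rangle,s\triangleleft|\eta|)^{-1}|s\bar\triangleright\eta|$; 3. $e\bar\triangleright\kappa=\kappa$, and $p\bar\triangleright(t\bar\triangleright\kappa)=((p'\cdot t)\bar\triangleright\kappa)\bar\triangleleft\tau(p'\triangleleft(t\triangleright|\kappa|),t\triangleleft|\kappa|)^{-1}$ with $p'=p\triangleleft\tau(\langle t\bar\triangleright\kappa\rangle,t\triangleleft|\kappa|)\,\tau(t,\langle\kappa\rangle)^{-1}$; 4. $(s\bar\triangleright\eta)\bar\triangleleft((s\triangleleft|\eta|)\triangleright u)=(s\triangleleft(\langle\eta\rangle\triangleright u))\bar\triangleright(\eta\bar\triangleleft u)$. Morphisms are the linear maps preserving both gradings and commuting with $\bar\triangleleft$ and $\bar\triangleright$. For objects $V,W$ give the vector space $V\otimes W$ the structure determined on homogeneous elements by $$\langle\xi\otimes\eta\rangle=\langle\xi\rangle\cdot\langle\eta\rangle,\qquad |\xi\otimes\eta|=\tau(\langle\xi\rangle,\langle\eta\rangle)^{-1}|\xi||\eta|,\qquad (\xi\otimes\eta)\bar\triangleleft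 u=\xi\bar\triangleleft(\langle\eta\rangle\triangleright u)\otimes\eta\bar\triangleleft u,$$ $$(s\triangleleft\tau(\langle\xi\rangle,\langle\eta\rangle))\bar\triangleright(\xi\otimes\eta)=(s\bar\triangleright\xi)\bar\triangleleft\,\tau(s\triangleleft|\xi|,\langle\eta\rangle)\,\tau(\langle(s\triangleleft|\xi|)\bar\triangleright\eta\rangle,s\triangleleft|\xi||\eta|)^{-1}\otimes(s\triangleleft|\xi|)\bar\triangleright\eta,$$ and let $(\theta\otimes\phi)(\xi\otimes\eta)=\theta(\xi)\otimes\phi(\eta)$ for morphisms $\theta,\phi$. **Theorem.** The spaces $V\otimes W$ are objects of $\mathcal D$, the maps $\theta\otimes\phi$ are morphisms of $\mathcal D$, the field $k$ with grades $\langle 1\rangle=e$, $|1|=e$ and trivial actions is an object of $\mathcal D$, and with this tensor product, the unit object $k$ and the following structure maps $\mathcal D$ is a braided tensor category. For homogeneous elements these maps are $$\Phi:(U\otimes V)\otimes W\to U\otimes(V\otimes W),\quad \Phi((\xi\otimes\eta)\otimes\zeta)=\xi\bar\triangleleft\tau(\langle\eta\rangle,\langle\zeta\rangle)\otimes(\eta\otimes\zeta),$$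 $$l_V:V\to V\otimes k,\quad l_V(\xi)=\xi\otimes 1,\qquad r_V:V\to k\otimes V,\quad r_V(\xi)=1\otimes\xi,$$ $$\Psi:V\otimes W\to W\otimes V,\quad \Psi(\xi\otimes\eta)=\langle\xi\rangle\bar\triangleright\eta\otimes\xi\bar\triangleleft|\eta|.$$ That is, $\Phi$, $l$, $r$ and $\Psi$ are natural isomorphisms in $\mathcal D$, the associator $\Phi$ satisfies the pentagon identity and, with $l$ and $r$, the triangle identity, and the braiding $\Psi$ satisfies both hexagon identities. -/

import Mathlib

open CategoryTheory TensorProduct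

universe w u

namespace CosetBraiding

section Cosets

variable {X : Type w} [Group X]

/-- A set `M` of left coset representatives for the subgroup `G` of `X` which contains the
identity: every `x : X` factors uniquely as `x = u * s` with `u ∈ G` and `s ∈ M`. -/
structure LeftCosetReps (G : Subgroup X) where
  M : Set X
  isComplement : Subgroup.IsComplement (G : Set X) M
  one_mem : (1 : X) ∈ M

namespace LeftCosetReps

variable {G : Subgroup X} (R : LeftCosetReps G)

/-- The factor `u ∈ G` of the unique factorisation `x = u * s`. -/
noncomputable def groupPart (x : X) : G :=
  ⟨(R.isComplement.equiv x).1, (R.isComplement.equiv x).1.2⟩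

/-- The factor `s ∈ M` of the unique factorisation `x = u * s`. -/
noncomputable def repPart (x : X) : R.M := (R.isComplement.equiv x).2

/-- The identity of `X` as an element of `M`. -/
def e : R.M := ⟨1, R.one_mem⟩

/-- `s t = τ(s,t) (s · t)`: the cocycle `τ(s,t) ∈ G`. -/
noncomputable def tau (s t : R.M) : G := R.groupPart ((s : X) * t)

/-- `s t = τ(s,t) (s · t)`: the product `s · t ∈ M`. -/
noncomputable def dot (s t : R.M) : R.M := R.repPart ((s : X) * t)

/-- `s u = (s ▷ u) (s ◁ u)`: the element `s ▷ u ∈ G`. -/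
noncomputable def la (s : R.M) (u : G) : G := R.groupPart ((s : X) * u)

/-- `s u = (s ▷ u) (s ◁ u)`: the element `s ◁ u ∈ M`. -/
noncomputable def ra (s : R.M) (u : G) : R.M := R.repPart ((s : X) * u)

/-- The finite set `M`, for sums over it. -/
@[reducible] noncomputable def fintypeReps [Finite X] : Fintype R.M := Fintype.ofFinite _

/-- The finite group `G`, for sums over it. -/
@[reducible] noncomputable def fintypeSubgroup [Finite X] (G : Subgroup X) : Fintype G := Fintype.ofFinite _

end LeftCosetReps

end Cosets

section Grading

variable {k : Type u} [Field k]

/-- A family of submodules with a matching complete family of projections is an internal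
direct sum decomposition. -/
theorem isInternal_of_projections {ι : Type*} [Fintype ι] [DecidableEq ι] {V : Type*} [AddCommGroup V] [Module k V]
    (A : ι → Submodule k V) (p : ι → V →ₗ[k] V) (hmem : ∀ i v, p i v ∈ A i)
    (hself : ∀ i, ∀ v ∈ A i, p i v = v) (hne : ∀ i j, i ≠ j → ∀ v ∈ A j, p i v = 0)
    (hsum : ∑ i, p i = LinearMap.id) : DirectSum.IsInternal A := by
  rw [DirectSum.isInternal_submodule_iff_iSupIndep_and_iSup_eq_top]
  constructor
  · intro i
    rw [Submodule.disjoint_def]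
    intro v hv hv'
    have h0 : (⨆ j, ⨆ (_ : j ≠ i), A j) ≤ LinearMap.ker (p i) :=
      iSup₂_le fun j hj v hv => hne i j (Ne.symm hj) v hv
    rw [← hself i v hv]
    exact h0 hv'
  · rw [eq_top_iff]
    intro v _
    have : v = ∑ i, p i v := by
      simpa using (LinearMap.congr_fun hsum v).symm
    rw [this]
    exact Submodule.sum_mem _ fun i _ => Submodule.mem_iSup_of_mem i (hmem i v)

end Grading

section Objects

attribute [local instance] LeftCosetReps.fintypeReps LeftCosetReps.fintypeSubgroup

variable {X : Type w} [Group X] {G : Subgroup X}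

open Classical in
/-- The raw data of an object, before the compatibility conditions: a finite dimensional vector
space with a decomposition `V = ⨁ V_{s,u}` over `s ∈ M`, `u ∈ G`, maps `ξ ↦ ξ ◁̄ u` for `u ∈ G`
and maps `ξ ↦ t ▷̄ ξ` for `t ∈ M`. The membership `ξ ∈ V.gr s u` means that `ξ` is homogeneous
with `⟨ξ⟩ = s` and `|ξ| = u`. -/
structure Data (k : Type u) [Field k] (R : LeftCosetReps G) where
  carrier : Type u
  [addCommGroup : AddCommGroup carrier]
  [module : Module k carrier]
  [finiteDimensional : FiniteDimensional k carrier]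
  gr : R.M → G → Submodule k carrier
  isInternal : DirectSum.IsInternal fun i : R.M × G => gr i.1 i.2
  act : G → carrier →ₗ[k] carrier
  mact : R.M → carrier →ₗ[k] carrier

attribute [instance] Data.addCommGroup Data.module Data.finiteDimensional

namespace Data

variable {k : Type u} [Field k] {R : LeftCosetReps G}

instance : CoeSort (Data k R) (Type u) := ⟨Data.carrier⟩

open Classical in
/-- The projection of `V = ⨁ V_{s,u}` onto the summand with index `i = (s,u)`. -/
noncomputable def proj (V : Data k R) (i : R.M × G) : V →ₗ[k] V :=
  (V.gr i.1 i.2).subtype ∘ₗ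
    DirectSum.component k (R.M × G) (fun i => V.gr i.1 i.2) i ∘ₗ
      (LinearEquiv.ofBijective
        (DirectSum.coeLinearMap fun i : R.M × G => V.gr i.1 i.2) V.isInternal).symm.toLinearMap

/-- The compatibility conditions for objects of the category `𝒟`. -/
structure IsObject (V : Data k R) : Prop where
  act_one : ∀ ξ : V, V.act 1 ξ = ξ
  act_mul : ∀ (u v : G) (ξ : V), V.act (u * v) ξ = V.act v (V.act u ξ)
  /-- `⟨η ◁̄ u⟩ = ⟨η⟩ ◁ u` and `|η ◁̄ u| = (⟨η⟩ ▷ u)⁻¹ |η| u` -/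
  act_mem : ∀ (a : R.M) (g u : G), ∀ η ∈ V.gr a g,
    V.act u η ∈ V.gr (R.ra a u) ((R.la a u)⁻¹ * g * u)
  /-- `s · ⟨η⟩ = ⟨s ▷̄ η⟩ · (s ◁ |η|)` and
  `τ(s,⟨η⟩)⁻¹ (s ▷ |η|) = τ(⟨s ▷̄ η⟩, s ◁ |η|)⁻¹ |s ▷̄ η|` -/
  mact_mem : ∀ (s a : R.M) (g : G), ∀ η ∈ V.gr a g, ∃ (c : R.M) (h : G),
    V.mact s η ∈ V.gr c h ∧
    R.dot s a = R.dot c (R.ra s g) ∧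
    (R.tau s a)⁻¹ * R.la s g = (R.tau c (R.ra s g))⁻¹ * h
  /-- `e ▷̄ ξ = ξ`: without it `▷̄ = 0` would be allowed -/
  one_mact : ∀ ξ : V, V.mact R.e ξ = ξ
  /-- `p ▷̄ (t ▷̄ κ) = ((p' · t) ▷̄ κ) ◁̄ τ(p' ◁ (t ▷ |κ|), t ◁ |κ|)⁻¹` where
  `p' = p ◁ τ(⟨t ▷̄ κ⟩, t ◁ |κ|) τ(t,⟨κ⟩)⁻¹` -/
  mact_mact : ∀ (p t b c : R.M) (h h' : G), ∀ κ ∈ V.gr b h, V.mact t κ ∈ V.gr c h' →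
    ∀ p' : R.M, p' = R.ra p (R.tau c (R.ra t h) * (R.tau t b)⁻¹) →
    V.mact p (V.mact t κ) =
      V.act (R.tau (R.ra p' (R.la t h)) (R.ra t h))⁻¹ (V.mact (R.dot p' t) κ)
  /-- `(s ▷̄ η) ◁̄ ((s ◁ |η|) ▷ u) = (s ◁ (⟨η⟩ ▷ u)) ▷̄ (η ◁̄ u)` -/
  cross : ∀ (s a : R.M) (g u : G), ∀ η ∈ V.gr a g,
    V.act (R.la (R.ra s g) u) (V.mact s η) = V.mact (R.ra s (R.la a u)) (V.act u η)

section Projections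

open Classical in
theorem proj_mem (V : Data k R) (i : R.M × G) (v : V) : V.proj i v ∈ V.gr i.1 i.2 := by
  simp [proj]

open Classical in
theorem proj_of_mem (V : Data k R) (i j : R.M × G) (v : V) (hv : v ∈ V.gr j.1 j.2) :
    V.proj i v = if i = j then v else 0 := by
  have h : (LinearEquiv.ofBijective
      (DirectSum.coeLinearMap fun i : R.M × G => V.gr i.1 i.2) V.isInternal).symm v =
      DirectSum.lof k (R.M × G) (fun i => V.gr i.1 i.2) j ⟨v, hv⟩ := by
    rw [LinearEquiv.symm_apply_eq]
    exact (DirectSum.coeLinearMap_lof (fun i : R.M × G => V.gr i.1 i.2) j ⟨v, hv⟩).symm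
  simp only [proj, LinearMap.comp_apply, LinearEquiv.coe_coe, h]
  split_ifs with hij
  · subst hij
    simp [DirectSum.component.lof_self]
  · rw [DirectSum.component.of, dif_neg (Ne.symm hij)]
    simp

theorem sum_proj [Finite X] (V : Data k R) : ∑ i, V.proj i = LinearMap.id := by
  classical
  ext v
  have htop := (DirectSum.isInternal_submodule_iff_iSupIndep_and_iSup_eq_top _).1 V.isInternal
  have hv : v ∈ ⨆ i : R.M × G, V.gr i.1 i.2 := by rw [htop.2]; trivial
  induction hv using Submodule.iSup_induction' with
  | mem j v hv => simp [V.proj_of_mem _ j v hv]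
  | zero => simp
  | add v w _ _ hv hw => rw [map_add, map_add, hv, hw]

end Projections

variable [Finite X]

/-- The projection onto `⨁_u V_{c,u}`, the summand of grade `⟨ξ⟩ = c`. -/
noncomputable def mproj (V : Data k R) (c : R.M) : V →ₗ[k] V := ∑ g : G, V.proj (c, g)

/-- `⟨ξ ⊗ η⟩ = ⟨ξ⟩ · ⟨η⟩` and `|ξ ⊗ η| = τ(⟨ξ⟩,⟨η⟩)⁻¹ |ξ| |η|` -/
noncomputable def tensorGrade (R : LeftCosetReps G) (i j : R.M × G) : R.M × G :=
  (R.dot i.1 j.1, (R.tau i.1 j.1)⁻¹ * i.2 * j.2)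

/-- The homogeneous subspaces of `V ⊗ W`. -/
noncomputable def tensorGr (V W : Data k R) (s : R.M) (u : G) : Submodule k (V ⊗[k] W) :=
  ⨆ (i : R.M × G) (j : R.M × G) (_ : tensorGrade R i j = (s, u)),
    Submodule.map₂ (TensorProduct.mk k V W) (V.gr i.1 i.2) (W.gr j.1 j.2)

open Classical in
theorem tensor_isInternal (V W : Data k R) :
    DirectSum.IsInternal fun i : R.M × G => tensorGr V W i.1 i.2 := by
  have key : ∀ l l' : R.M × G, ∀ x ∈ tensorGr V W l'.1 l'.2,
      (∑ i, ∑ j, if tensorGrade R i j = l then TensorProduct.map (V.proj i) (W.proj j) else 0) x =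
        if l = l' then x else 0 := by
    intro l l' x hx
    have hle : tensorGr V W l'.1 l'.2 ≤ LinearMap.eqLocus
        (∑ i, ∑ j, if tensorGrade R i j = l then TensorProduct.map (V.proj i) (W.proj j) else 0)
        (if l = l' then LinearMap.id else 0) := by
      refine iSup_le fun i => iSup_le fun j => iSup_le fun hij => ?_
      rw [Submodule.map₂_le]
      intro v hv w hw
      have h : ∀ i' j' : R.M × G, (if tensorGrade R i' j' = l then
          TensorProduct.map (V.proj i') (W.proj j') else 0) (v ⊗ₜ[k] w) =
          if i' = i then (if j' = j then (if l = l' then v ⊗ₜ[k] w else 0) else 0) else 0 := by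
        intro i' j'
        by_cases hi : i' = i
        · by_cases hj : j' = j
          · subst hi hj
            have hij' : tensorGrade R i' j' = l' := hij
            rw [hij']
            by_cases hl : l = l'
            · subst hl
              simp [V.proj_of_mem _ i' v hv, W.proj_of_mem _ j' w hw]
            · simp [hl, Ne.symm hl]
          · split_ifs <;> simp [W.proj_of_mem _ j w hw, hj]
        · split_ifs <;> simp [V.proj_of_mem _ i v hv, hi]
      simp only [LinearMap.mem_eqLocus, LinearMap.sum_apply, TensorProduct.mk_apply, h]
      split_ifs <;> simp
    have := hle hx
    rw [LinearMap.mem_eqLocus] at this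
    rw [this]
    split_ifs <;> rfl
  refine isInternal_of_projections _ (fun l => ∑ i, ∑ j, if tensorGrade R i j = l then
      TensorProduct.map (V.proj i) (W.proj j) else 0) ?_ ?_ ?_ ?_
  · intro l x
    induction x using TensorProduct.induction_on with
    | zero => rw [map_zero]; exact zero_mem _
    | add x y hx hy => rw [map_add]; exact add_mem hx hy
    | tmul v w =>
      simp only [LinearMap.sum_apply]
      refine Submodule.sum_mem _ fun i _ => Submodule.sum_mem _ fun j _ => ?_
      split_ifs with h
      · refine Submodule.mem_iSup_of_mem i (Submodule.mem_iSup_of_mem j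
          (Submodule.mem_iSup_of_mem h ?_))
        exact Submodule.apply_mem_map₂ _ (V.proj_mem i v) (W.proj_mem j w)
      · exact zero_mem _
  · intro l x hx
    simpa using key l l x hx
  · intro l l' hl x hx
    simpa [hl] using key l l' x hx
  · have h1 : ∀ i j : R.M × G, (∑ l, if tensorGrade R i j = l then
        TensorProduct.map (V.proj i) (W.proj j) else 0) =
        TensorProduct.map (V.proj i) (W.proj j) := fun i j => by simp
    rw [Finset.sum_comm]
    have h2 : ∀ i : R.M × G, (∑ l, ∑ j, if tensorGrade R i j = l then
        TensorProduct.map (V.proj i) (W.proj j) else 0) =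
        TensorProduct.map (V.proj i) LinearMap.id := fun i => by
      rw [Finset.sum_comm, Finset.sum_congr rfl fun j _ => h1 i j, ← W.sum_proj]
      exact (map_sum (TensorProduct.mapBilinear (RingHom.id k) V W V W (V.proj i)) W.proj
        Finset.univ).symm
    rw [Finset.sum_congr rfl fun i _ => h2 i]
    have h3 := map_sum ((TensorProduct.mapBilinear (RingHom.id k) V W V W).flip LinearMap.id)
      V.proj Finset.univ
    rw [V.sum_proj] at h3
    exact h3.symm.trans TensorProduct.map_id

/-- The `G`-action on `V ⊗ W`, for homogeneous `η`:
`(ξ ⊗ η) ◁̄ u = ξ ◁̄ (⟨η⟩ ▷ u) ⊗ η ◁̄ u`. The sum runs over the possible values `b` of `⟨η⟩`. -/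
noncomputable def tensorAct (V W : Data k R) (u : G) : V ⊗[k] W →ₗ[k] V ⊗[k] W :=
  ∑ b : R.M, TensorProduct.map (V.act (R.la b u)) (W.act u ∘ₗ W.mproj b)

/-- The `M`-action on `V ⊗ W`, for homogeneous `η` and `κ`:
`t ▷̄ (η ⊗ κ) = (s ▷̄ η) ◁̄ τ(s ◁ |η|, ⟨κ⟩) τ(⟨(s ◁ |η|) ▷̄ κ⟩, s ◁ |η||κ|)⁻¹ ⊗ (s ◁ |η|) ▷̄ κ`,
where `t = s ◁ τ(⟨η⟩,⟨κ⟩)`. The sums run over the possible values `i` of `(⟨η⟩,|η|)`, `j` of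
`(⟨κ⟩,|κ|)` and `c` of `⟨(s ◁ |η|) ▷̄ κ⟩`. -/
noncomputable def tensorMact (V W : Data k R) (t : R.M) : V ⊗[k] W →ₗ[k] V ⊗[k] W :=
  ∑ i : R.M × G, ∑ j : R.M × G, ∑ c : R.M,
    let s : R.M := R.ra t (R.tau i.1 j.1)⁻¹
    TensorProduct.map
      (V.act (R.tau (R.ra s i.2) j.1 * (R.tau c (R.ra s (i.2 * j.2)))⁻¹) ∘ₗ V.mact s ∘ₗ V.proj i)
      (W.mproj c ∘ₗ W.mact (R.ra s i.2) ∘ₗ W.proj j)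

/-- The tensor product `V ⊗ W`. -/
noncomputable def tensor (V W : Data k R) : Data k R where
  carrier := V ⊗[k] W
  gr := tensorGr V W
  isInternal := tensor_isInternal V W
  act := tensorAct V W
  mact := tensorMact V W

open Classical in
theorem unit_isInternal (k : Type u) [Field k] (R : LeftCosetReps G) :
    DirectSum.IsInternal fun i : R.M × G =>
      (if i.1 = R.e ∧ i.2 = 1 then ⊤ else ⊥ : Submodule k k) := by
  refine isInternal_of_projections _
    (fun i => if i = (R.e, (1 : G)) then LinearMap.id else 0) ?_ ?_ ?_ ?_
  · intro i v
    by_cases hi : i.1 = R.e ∧ i.2 = 1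
    · rw [if_pos hi]
      exact Submodule.mem_top
    · rw [if_neg fun h => hi ⟨congrArg Prod.fst h, congrArg Prod.snd h⟩]
      exact zero_mem _
  · intro i v hv
    by_cases hi : i.1 = R.e ∧ i.2 = 1
    · simp [hi, Prod.ext_iff]
    · simp only [hi, if_false, Submodule.mem_bot] at hv
      simp [hv]
  · intro i j hij v hv
    by_cases hj : j.1 = R.e ∧ j.2 = 1
    · have : i ≠ (R.e, 1) := fun h => hij (h.trans (Prod.ext hj.1.symm hj.2.symm))
      simp [this]
    · simp only [hj, if_false, Submodule.mem_bot] at hv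
      simp [hv]
  · simp

open Classical in
/-- The field `k` with grades `e` and trivial actions. -/
noncomputable def unit (k : Type u) [Field k] (R : LeftCosetReps G) : Data k R where
  carrier := k
  gr s u := if s = R.e ∧ u = 1 then ⊤ else ⊥
  isInternal := unit_isInternal k R
  act _ := LinearMap.id
  mact _ := LinearMap.id

end Data

end Objects

section Category

variable {X : Type w} [Group X] {G : Subgroup X}

/-- Objects of the category `𝒟`. -/
structure D (k : Type u) [Field k] (R : LeftCosetReps G) where
  data : Data k R
  isObject : data.IsObject

variable {k : Type u} [Field k] {R : LeftCosetReps G}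

namespace D

instance : CoeSort (D k R) (Type u) := ⟨fun V => V.data.carrier⟩

/-- Morphisms of `𝒟`: linear maps preserving both gradings and both actions. -/
@[ext]
structure Hom (V W : D k R) where
  lin : V →ₗ[k] W
  map_gr : ∀ (s : R.M) (u : G), ∀ ξ ∈ V.data.gr s u, lin ξ ∈ W.data.gr s u
  map_act : ∀ (u : G) (ξ : V), lin (V.data.act u ξ) = W.data.act u (lin ξ)
  map_mact : ∀ (t : R.M) (ξ : V), lin (V.data.mact t ξ) = W.data.mact t (lin ξ)

instance : Category (D k R) where
  Hom := Hom
  id V := ⟨LinearMap.id, fun _ _ _ h => h, fun _ _ => rfl, fun _ _ => rfl⟩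
  comp f g := ⟨g.lin ∘ₗ f.lin, fun s u ξ h => g.map_gr s u _ (f.map_gr s u ξ h),
    fun u ξ => by simp [f.map_act, g.map_act], fun t ξ => by simp [f.map_mact, g.map_mact]⟩

/-- The linear map underlying a morphism of `𝒟`. -/
def linear {V W : D k R} (f : V ⟶ W) : V →ₗ[k] W := Hom.lin f

end D

end Category

section BraidedData

/-- The data of a braided tensor category, without its axioms. -/
structure BraidedData (C : Type*) [Category C] extends MonoidalCategoryStruct C where
  braiding : ∀ V W : C, tensorObj V W ≅ tensorObj W V

/-- The data underlying a braided tensor category. -/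
def BraidedData.of (C : Type*) [Category C] [m : MonoidalCategory C] [b : BraidedCategory C] :
    BraidedData C where
  toMonoidalCategoryStruct := m.toMonoidalCategoryStruct
  braiding := b.braiding

end BraidedData

end CosetBraiding

open CosetBraiding

namespace CosetBraiding

/-! ### The factorisation `X = GM` and calculus with coset representatives -/

namespace LeftCosetReps

variable {X : Type w} [Group X] {G : Subgroup X} (R : LeftCosetReps G)

/-! Objects of `𝒟` are crossed `X`-modules in disguise. Since `(s,u) ↦ u⁻¹s` is a bijection from `M
× G` to `X`, the two gradings form one grading `‖ξ‖ = |ξ|⁻¹⟨ξ⟩` by `X`. The two actions form one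
action `ρ` of `X`, with `ξ ◁̄ u = ρ(u⁻¹)ξ` and `s ▷̄ ξ = ρ(s ◁ |ξ|)ξ`. The axioms of `𝒟` then say
exactly that `ρ` is a representation and that `ρ(y)` carries degree `x` to degree `yxy⁻¹`
(`IsObject.isCrossed` and `IsCrossed.isObject`).

The tensor product is the usual one, twisted: `ξ ⊗ η ↦ ρ(|η|⁻¹)ξ ⊗ η` makes the action of `X`
diagonal and the degree of a tensor the product of the degrees. It also turns `Φ` into the identity
and `Ψ` into the standard braiding `ξ ⊗ η ↦ ρ(‖ξ‖)η ⊗ ξ`, which is why the axioms hold.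

The proof does not transport along this twist. It expresses every structure map through `ρ`
(`rho_tmul`, `associator_tmul`, `braiding_tmul`), so that on homogeneous tensors each axiom asks
that the same element of `X` act on each factor. These identities in `X` are `pentagon_rho`,
`hexagon_forward_rho`, `hexagon_reverse_rho` and `hexagon_reverse_rho'`; `conj_tdeg`, `tdeg_tdeg`,
`braid_tdeg` and `braid_rho` do the same for degrees and equivariance. -/

theorem groupPart_mul_repPart (x : X) : (R.groupPart x : X) * R.repPart x = x :=
  R.isComplement.equiv_fst_mul_equiv_snd x

theorem factor_unique {u v : G} {s t : R.M} (h : (u : X) * s = v * t) : u = v ∧ s = t := by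
  have := R.isComplement.1 (show (fun x : ↥(G : Set X) × R.M => (x.1 : X) * x.2) (⟨u, u.2⟩, s) =
    (fun x : ↥(G : Set X) × R.M => (x.1 : X) * x.2) (⟨v, v.2⟩, t) from h)
  simp only [Prod.mk.injEq, Subtype.mk.injEq, SetLike.coe_eq_coe] at this
  exact this

theorem coe_groupPart (x : X) : (R.groupPart x : X) = x * (R.repPart x : X)⁻¹ :=
  eq_mul_inv_of_mul_eq (R.groupPart_mul_repPart x)

theorem repPart_coe_mul (u : G) (x : X) : R.repPart (u * x) = R.repPart x := by
  refine (R.factor_unique (u := R.groupPart (u * x)) (v := u * R.groupPart x) ?_).2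
  rw [groupPart_mul_repPart, Subgroup.coe_mul, mul_assoc, groupPart_mul_repPart]

theorem repPart_coe_inv_mul (u : G) (x : X) : R.repPart ((u : X)⁻¹ * x) = R.repPart x :=
  R.repPart_coe_mul u⁻¹ x

theorem repPart_coe (s : R.M) : R.repPart s = s := by
  refine (R.factor_unique (u := R.groupPart s) (v := 1) ?_).2
  rw [groupPart_mul_repPart]
  simp

/-- `repPart` depends only on the coset `Gx`, and right multiplication acts on these cosets.
Dropping inner occurrences of `repPart` in this way, after expanding `τ` and `▷` in `X`, normalises
most identities below. -/
theorem repPart_repPart_mul (x y : X) : R.repPart (R.repPart x * y) = R.repPart (x * y) := by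
  rw [← R.repPart_coe_mul (R.groupPart x), ← mul_assoc, groupPart_mul_repPart]

theorem coe_e : (R.e : X) = 1 := rfl

theorem repPart_one : R.repPart 1 = R.e := R.repPart_coe R.e

theorem repPart_subgroup (u : G) : R.repPart (u : X) = R.e := by
  rw [← mul_one (u : X), repPart_coe_mul, repPart_one]

theorem coe_tau (s t : R.M) : (R.tau s t : X) = s * t * (R.repPart (s * t) : X)⁻¹ :=
  R.coe_groupPart _

theorem coe_la (s : R.M) (u : G) : (R.la s u : X) = s * u * (R.repPart (s * u) : X)⁻¹ :=
  R.coe_groupPart _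

theorem dot_eq (s t : R.M) : R.dot s t = R.repPart (s * t) := rfl

theorem ra_eq (s : R.M) (u : G) : R.ra s u = R.repPart (s * u) := rfl

theorem ra_mul (s : R.M) (u v : G) : R.ra s (u * v) = R.ra (R.ra s u) v := by
  simp [ra_eq, repPart_repPart_mul, mul_assoc]

theorem ra_one (s : R.M) : R.ra s 1 = s := by
  simp [ra_eq, repPart_coe]

/-- The first component `|ξ|` of a homogeneous element with `‖ξ‖ = |ξ|⁻¹ ⟨ξ⟩ = x`. -/
noncomputable def gdeg (x : X) : G := (R.groupPart x)⁻¹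

theorem coe_gdeg (x : X) : (R.gdeg x : X) = R.repPart x * x⁻¹ := by
  simp [gdeg, coe_groupPart]

theorem gdeg_inv_mul_repPart (x : X) : (R.gdeg x : X)⁻¹ * R.repPart x = x := by
  simp [coe_gdeg]

theorem gdeg_mul (x : X) : (R.gdeg x : X) * x = R.repPart x := by
  simp [coe_gdeg]

theorem gdeg_one : R.gdeg 1 = 1 := by
  ext
  simp [coe_gdeg, repPart_one, coe_e]

theorem repPart_inv_mul (g : G) (a : R.M) : R.repPart ((g : X)⁻¹ * a) = a := by
  rw [repPart_coe_inv_mul, repPart_coe]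

theorem gdeg_inv_mul (g : G) (a : R.M) : R.gdeg ((g : X)⁻¹ * a) = g := by
  ext
  simp [coe_gdeg, repPart_inv_mul]

end LeftCosetReps

/-! ### The single grading by `X` -/

section Homogeneous

attribute [local instance] LeftCosetReps.fintypeReps LeftCosetReps.fintypeSubgroup

variable {X : Type w} [Group X] {G : Subgroup X} {k : Type u} [Field k] {R : LeftCosetReps G}

namespace Data

/-- The homogeneous elements with `‖ξ‖ = |ξ|⁻¹ ⟨ξ⟩ = x`. -/
noncomputable def xgr (V : Data k R) (x : X) : Submodule k V := V.gr (R.repPart x) (R.gdeg x)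

theorem gr_eq_xgr (V : Data k R) (a : R.M) (g : G) : V.gr a g = V.xgr ((g : X)⁻¹ * a) := by
  rw [xgr, R.repPart_inv_mul, R.gdeg_inv_mul]

theorem mem_xgr_of_mem_gr {V : Data k R} {a : R.M} {g : G} {ξ : V} (h : ξ ∈ V.gr a g) {x : X}
    (hx : (g : X)⁻¹ * a = x) : ξ ∈ V.xgr x := by
  rwa [← hx, ← gr_eq_xgr]

theorem mem_gr_of_mem_xgr {V : Data k R} {a : R.M} {g : G} {ξ : V} {x : X} (h : ξ ∈ V.xgr x)
    (hx : (g : X)⁻¹ * a = x) : ξ ∈ V.gr a g := by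
  rwa [gr_eq_xgr, hx]

theorem eq_of_mem_xgr {V : Data k R} {x y : X} {ξ : V} (hx : ξ ∈ V.xgr x) (hy : ξ ∈ V.xgr y)
    (h0 : ξ ≠ 0) : x = y := by
  classical
  have h := V.proj_of_mem (R.repPart x, R.gdeg x) (R.repPart x, R.gdeg x) ξ hx
  rw [V.proj_of_mem (R.repPart x, R.gdeg x) (R.repPart y, R.gdeg y) ξ hy, if_pos rfl] at h
  split_ifs at h with hxy
  · simp only [Prod.mk.injEq] at hxy
    rw [← R.gdeg_inv_mul_repPart x, hxy.1, hxy.2, R.gdeg_inv_mul_repPart]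
  · exact absurd h.symm h0

variable [Finite X]

theorem induction_xgr {V : Data k R} {p : V → Prop} (ξ : V) (hom : ∀ x, ∀ ξ ∈ V.xgr x, p ξ)
    (add : ∀ ξ η, p ξ → p η → p (ξ + η)) : p ξ := by
  have h := LinearMap.congr_fun V.sum_proj ξ
  rw [LinearMap.id_apply, LinearMap.sum_apply] at h
  rw [← h]
  -- The value at `0`, required for the empty sum, comes from `0` being homogeneous of degree `1`.
  exact Finset.sum_induction _ p add (hom 1 0 (zero_mem _))
    fun i _ => hom _ _ (mem_xgr_of_mem_gr (V.proj_mem i ξ) rfl)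

theorem lin_ext {V : Data k R} {Z : Type*} [AddCommGroup Z] [Module k Z] {f g : V →ₗ[k] Z}
    (h : ∀ x, ∀ ξ ∈ V.xgr x, f ξ = g ξ) : f = g :=
  LinearMap.ext fun ξ => induction_xgr ξ h fun ξ η h h' => by rw [map_add, map_add, h, h']

/-- The linear map on `V` given by `f x` on the homogeneous elements with `‖ξ‖ = x`. -/
noncomputable def glue (V : Data k R) {Z : Type*} [AddCommGroup Z] [Module k Z]
    (f : X → V →ₗ[k] Z) : V →ₗ[k] Z :=
  ∑ i : R.M × G, f ((i.2 : X)⁻¹ * i.1) ∘ₗ V.proj i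

theorem glue_apply (V : Data k R) {Z : Type*} [AddCommGroup Z] [Module k Z]
    (f : X → V →ₗ[k] Z) {x : X} {ξ : V} (h : ξ ∈ V.xgr x) : V.glue f ξ = f x ξ := by
  classical
  rw [glue, LinearMap.sum_apply, Finset.sum_eq_single (R.repPart x, R.gdeg x)]
  · rw [LinearMap.comp_apply, V.proj_of_mem _ (R.repPart x, R.gdeg x) ξ h, if_pos rfl]
    simp only [R.gdeg_inv_mul_repPart]
  · intro i _ hi
    rw [LinearMap.comp_apply, V.proj_of_mem _ (R.repPart x, R.gdeg x) ξ h, if_neg hi, map_zero]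
  · simp

/-- The tensor product of elements, with values in the carrier of `V.tensor W`. -/
noncomputable def tmul {V W : Data k R} : V →ₗ[k] W →ₗ[k] V.tensor W := TensorProduct.mk k V W

theorem tensor_ext {V W : Data k R} {Z : Type*} [AddCommGroup Z] [Module k Z]
    {f g : V.tensor W →ₗ[k] Z}
    (h : ∀ x y, ∀ ξ ∈ V.xgr x, ∀ η ∈ W.xgr y, f (tmul ξ η) = g (tmul ξ η)) : f = g :=
  TensorProduct.ext (M := V) (N := W) <|
    lin_ext fun x ξ hξ => lin_ext fun y η hη => h x y ξ hξ η hη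

/-- The linear map on `V ⊗ W` given by `f x y` on the tensors `ξ ⊗ η` of homogeneous elements
with `‖ξ‖ = x` and `‖η‖ = y`. -/
noncomputable def glue₂ (V W : Data k R) {Z : Type*} [AddCommGroup Z] [Module k Z]
    (f : X → X → V →ₗ[k] W →ₗ[k] Z) : V.tensor W →ₗ[k] Z :=
  TensorProduct.lift (M := V) (N := W) (V.glue fun x => (W.glue fun y => (f x y).flip).flip)

theorem glue₂_apply (V W : Data k R) {Z : Type*} [AddCommGroup Z] [Module k Z]
    (f : X → X → V →ₗ[k] W →ₗ[k] Z) {x y : X} {ξ : V} {η : W} (hξ : ξ ∈ V.xgr x)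
    (hη : η ∈ W.xgr y) : V.glue₂ W f (tmul ξ η) = f x y ξ η := by
  refine (TensorProduct.lift.tmul (M := V) (N := W) ξ η).trans ?_
  rw [glue_apply _ _ hξ, LinearMap.flip_apply, glue_apply _ _ hη, LinearMap.flip_apply]

end Data

end Homogeneous

/-! ### Objects of `𝒟` as crossed `X`-modules -/

section Crossed

variable {X : Type w} [Group X] {G : Subgroup X} {k : Type u} [Field k] {R : LeftCosetReps G}

namespace Data

/-- A linear action `ρ` of `X` on `V` making it a crossed `X`-module for the grading `‖ξ‖`, from
which the actions of `G` and `M` are obtained by `ξ ◁̄ u = ρ(u⁻¹) ξ` and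
`s ▷̄ ξ = ρ(s ◁ |ξ|) ξ`. -/
structure IsCrossed (V : Data k R) (ρ : X →* Module.End k V) : Prop where
  act_eq : ∀ (u : G) (ξ : V), V.act u ξ = ρ (u : X)⁻¹ ξ
  mact_eq : ∀ (s : R.M) (x : X), ∀ ξ ∈ V.xgr x, V.mact s ξ = ρ (R.ra s (R.gdeg x) : X) ξ
  mem : ∀ (y x : X), ∀ ξ ∈ V.xgr x, ρ y ξ ∈ V.xgr (y * x * y⁻¹)

theorem IsCrossed.map_mul_apply {V : Data k R} {ρ : X →* Module.End k V} (x y : X) (ξ : V) :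
    ρ x (ρ y ξ) = ρ (x * y) ξ := by
  rw [map_mul, Module.End.mul_apply]

namespace IsObject

variable {V : Data k R}
theorem act_mem_xgr (hV : V.IsObject) {x : X} {ξ : V} (h : ξ ∈ V.xgr x) (u : G) :
    V.act u ξ ∈ V.xgr ((u : X)⁻¹ * x * u) := by
  refine mem_xgr_of_mem_gr (hV.act_mem _ _ u ξ h) ?_
  simp [R.coe_la, R.ra_eq, R.coe_gdeg, mul_assoc]

theorem mact_mem_xgr (hV : V.IsObject) {x : X} {ξ : V} (h : ξ ∈ V.xgr x) (s : R.M) :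
    V.mact s ξ ∈ V.xgr ((R.ra s (R.gdeg x) : X) * x * (R.ra s (R.gdeg x) : X)⁻¹) := by
  obtain ⟨c, g, hm, h1, h2⟩ := hV.mact_mem s _ _ ξ h
  refine mem_xgr_of_mem_gr hm ?_
  have h3 := congrArg (Subtype.val : G → X) (congrArg (·⁻¹) h2)
  have h1' : R.repPart (s * R.repPart x) = R.repPart (c * (R.repPart (s * R.gdeg x))) := h1
  simp only [mul_inv_rev, inv_inv, Subgroup.coe_mul, Subgroup.coe_inv, R.coe_tau, R.coe_la,
    R.ra_eq, ← mul_assoc] at h3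
  rw [h1'] at h3
  -- By `h1'` both sides of `h3` end in the same inverse representative. Cancelling it leaves `(s ▷
  -- g)⁻¹ s a = h⁻¹ c (s ◁ g)` in the notation of the axiom, and `(s ▷ g)⁻¹ s = (s ◁ g) g⁻¹`.
  rw [R.ra_eq, eq_mul_inv_iff_mul_eq, ← mul_right_cancel h3]
  simp [R.coe_gdeg, mul_assoc]

/-- Replacing `s` by `s ◁ |ξ|⁻¹` removes the twist in `▷̄`: the cross axiom becomes `ρ(s ◁ u) ρ(u⁻¹)
= ρ((s ▷ u)⁻¹) ρ(s)`, which is the factorisation `su = (s ▷ u)(s ◁ u)`. -/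
theorem cross_xgr (hV : V.IsObject) {x : X} {ξ : V} (h : ξ ∈ V.xgr x) (s : R.M) (u : G) :
    V.mact (R.ra (R.ra s u) (R.gdeg ((u : X)⁻¹ * x * u))⁻¹) (V.act u ξ) =
      V.act (R.la s u) (V.mact (R.ra s (R.gdeg x)⁻¹) ξ) := by
  have := hV.cross (R.ra s (R.gdeg x)⁻¹) _ _ u ξ h
  rw [← R.ra_mul, inv_mul_cancel, R.ra_one, ← R.ra_mul] at this
  rw [this, ← R.ra_mul]
  congr 3
  ext
  simp [R.coe_gdeg, R.coe_la, R.repPart_coe_inv_mul, mul_assoc, R.repPart_repPart_mul]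

/-- With the same shift, the axiom on iterated `▷̄` becomes `ρ(p) ρ(t) = ρ(τ(p,t)) ρ(p · t)`, the
factorisation of `pt`. -/
theorem mact_mact_xgr (hV : V.IsObject) {x : X} {ξ : V} (h : ξ ∈ V.xgr x) (p t : R.M) :
    V.mact (R.ra p (R.gdeg ((t : X) * x * (t : X)⁻¹))⁻¹) (V.mact (R.ra t (R.gdeg x)⁻¹) ξ) =
      V.act (R.tau p t)⁻¹ (V.mact (R.ra (R.dot p t) (R.gdeg x)⁻¹) ξ) := by
  have hm := hV.mact_mem_xgr h (R.ra t (R.gdeg x)⁻¹)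
  rw [← R.ra_mul, inv_mul_cancel, R.ra_one] at hm
  -- The `p'` of the axiom simplifies to `p ◁ (t' ▷ |ξ|)⁻¹` with `t' = t ◁ |ξ|⁻¹`. Hence `p' ◁ (t' ▷
  -- |ξ|) = p` and `p' · t' = (p · t) ◁ |ξ|⁻¹`.
  have hp : R.ra p (R.la (R.ra t (R.gdeg x)⁻¹) (R.gdeg x))⁻¹ =
      R.ra (R.ra p (R.gdeg (t * x * (t : X)⁻¹))⁻¹)
        (R.tau (R.repPart (t * x * (t : X)⁻¹)) (R.ra (R.ra t (R.gdeg x)⁻¹) (R.gdeg x)) *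
          (R.tau (R.ra t (R.gdeg x)⁻¹) (R.repPart x))⁻¹) := by
    rw [← R.ra_mul _ (R.gdeg x)⁻¹, inv_mul_cancel, R.ra_one, ← R.ra_mul]
    congr 1
    ext
    simp [R.coe_gdeg, R.coe_tau, R.coe_la, R.ra_eq, R.repPart_coe, R.repPart_repPart_mul,
      mul_assoc]
  rw [hV.mact_mact _ _ _ _ _ _ ξ h hm _ hp, ← R.ra_mul p, ← R.ra_mul t, inv_mul_cancel,
    inv_mul_cancel, R.ra_one, R.ra_one]
  congr 3
  simp [R.ra_eq, R.dot_eq, R.coe_la, R.repPart_coe, R.repPart_repPart_mul, mul_assoc]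

end IsObject

variable [Finite X]

/-- The linear map by which `y ∈ X` acts on an object. -/
noncomputable def rhoFun (V : Data k R) (y : X) : Module.End k V :=
  V.glue fun x => V.act (R.groupPart y)⁻¹ ∘ₗ V.mact (R.ra (R.repPart y) (R.gdeg x)⁻¹)

theorem rhoFun_apply (V : Data k R) (y : X) {x : X} {ξ : V} (h : ξ ∈ V.xgr x) :
    V.rhoFun y ξ = V.act (R.groupPart y)⁻¹ (V.mact (R.ra (R.repPart y) (R.gdeg x)⁻¹) ξ) :=
  V.glue_apply _ h

theorem IsObject.rhoFun_mem {V : Data k R} (hV : V.IsObject) (y : X) {x : X} {ξ : V}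
    (h : ξ ∈ V.xgr x) : V.rhoFun y ξ ∈ V.xgr (y * x * y⁻¹) := by
  rw [rhoFun_apply V y h]
  convert hV.act_mem_xgr (hV.mact_mem_xgr h _) _ using 2
  simp [← R.ra_mul, R.ra_one, R.coe_groupPart, mul_assoc]

theorem IsObject.rhoFun_mul {V : Data k R} (hV : V.IsObject) (y z : X) :
    V.rhoFun (y * z) = V.rhoFun y * V.rhoFun z := by
  refine lin_ext fun x ξ h => ?_
  rw [Module.End.mul_apply, rhoFun_apply V _ (hV.rhoFun_mem z h), rhoFun_apply V _ h,
    rhoFun_apply V _ h]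
  have hm := hV.mact_mem_xgr h (R.ra (R.repPart z) (R.gdeg x)⁻¹)
  rw [← R.ra_mul, inv_mul_cancel, R.ra_one] at hm
  -- Write `y = vs` and `z = wt` with `v, w ∈ G` and `s, t ∈ M`. The cross relation at `s ◁ w` and
  -- `w⁻¹` moves `ρ(w)` to the left of `ρ(s)`; then `ρ(s ◁ w) ρ(t)` is contracted by
  -- `mact_mact_xgr`, and only actions of `G` remain to be merged.
  have h1 := hV.cross_xgr hm (R.ra (R.repPart y) (R.groupPart z)) (R.groupPart z)⁻¹
  rw [← R.ra_mul (R.repPart y), mul_inv_cancel, R.ra_one, hV.mact_mact_xgr h] at h1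
  have h2 : (((R.groupPart z)⁻¹ : G) : X)⁻¹ * (R.repPart z * x * (R.repPart z : X)⁻¹) *
      ((R.groupPart z)⁻¹ : G) = z * x * z⁻¹ := by
    simp [R.coe_groupPart, mul_assoc]
  rw [h2] at h1
  rw [h1, ← hV.act_mul, ← hV.act_mul]
  have h3 : R.dot (R.ra (R.repPart y) (R.groupPart z)) (R.repPart z) = R.repPart (y * z) := by
    simp [R.dot_eq, R.ra_eq, R.repPart_repPart_mul, mul_assoc, R.groupPart_mul_repPart]
  rw [h3]
  congr 2
  ext
  simp [R.coe_la, R.coe_tau, R.coe_groupPart, R.ra_eq, R.repPart_repPart_mul, mul_assoc]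

theorem IsObject.rhoFun_one {V : Data k R} (hV : V.IsObject) : V.rhoFun 1 = 1 := by
  refine lin_ext fun x ξ h => ?_
  have h1 : R.groupPart 1 = 1 := by ext; simp [R.coe_groupPart, R.repPart_one, R.coe_e]
  have h2 : R.ra (R.repPart 1) (R.gdeg x)⁻¹ = R.e := by
    rw [R.repPart_one, R.ra_eq, R.coe_e, one_mul, R.repPart_subgroup]
  rw [rhoFun_apply V _ h, h1, h2, inv_one, hV.act_one, hV.one_mact, Module.End.one_apply]

/-- The action of `X` on an object. -/
noncomputable def IsObject.rho {V : Data k R} (hV : V.IsObject) : X →* Module.End k V where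
  toFun := V.rhoFun
  map_one' := hV.rhoFun_one
  map_mul' := hV.rhoFun_mul

theorem IsObject.isCrossed {V : Data k R} (hV : V.IsObject) : V.IsCrossed hV.rho where
  act_eq u ξ := by
    induction ξ using induction_xgr with
    | add ξ η h h' => rw [map_add, map_add, h, h']
    | hom x ξ h =>
      have h1 : R.groupPart (u : X)⁻¹ = u⁻¹ := by
        ext
        simp [R.coe_groupPart, ← Subgroup.coe_inv, R.repPart_subgroup, R.coe_e,
          -InvMemClass.coe_inv]
      have h2 : R.ra (R.repPart (u : X)⁻¹) (R.gdeg x)⁻¹ = R.e := by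
        rw [← Subgroup.coe_inv, R.repPart_subgroup, R.ra_eq, R.coe_e, one_mul, R.repPart_subgroup]
      refine Eq.trans ?_ (rhoFun_apply V _ h).symm
      rw [h1, h2, inv_inv, hV.one_mact]
  mact_eq s x ξ h := by
    have h1 : R.groupPart (R.ra s (R.gdeg x) : X) = 1 := by
      ext
      simp [R.coe_groupPart, R.repPart_coe]
    refine Eq.trans ?_ (rhoFun_apply V _ h).symm
    rw [h1, inv_one, hV.act_one, R.repPart_coe, ← R.ra_mul, mul_inv_cancel, R.ra_one]
  mem y x ξ h := hV.rhoFun_mem y h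

/-- The action is unique: its values on `G` and `M` are prescribed, and `X = GM`. This identifies an
explicit action, such as that on a tensor product, with the one recovered from the axioms. -/
theorem IsCrossed.apply_eq_rhoFun {V : Data k R} {ρ : X →* Module.End k V} (hρ : V.IsCrossed ρ)
    (y : X) : ρ y = V.rhoFun y := by
  refine lin_ext fun x ξ h => ?_
  rw [rhoFun_apply V y h, hρ.act_eq, hρ.mact_eq _ x ξ h, ← R.ra_mul, inv_mul_cancel, R.ra_one,
    map_mul_apply, Subgroup.coe_inv, inv_inv, R.groupPart_mul_repPart]

theorem IsCrossed.isObject {V : Data k R} {ρ : X →* Module.End k V} (hρ : V.IsCrossed ρ) :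
    V.IsObject where
  act_one ξ := by simp [hρ.act_eq]
  act_mul u v ξ := by simp [hρ.act_eq]
  act_mem a g u η h := by
    rw [hρ.act_eq]
    refine mem_gr_of_mem_xgr (hρ.mem _ _ _ (mem_xgr_of_mem_gr h rfl)) ?_
    simp [R.coe_la, R.ra_eq, mul_assoc]
  mact_mem s a g η h := by
    have h' := mem_xgr_of_mem_gr h rfl
    have hm := hρ.mem (R.ra s g) _ _ h'
    rw [← R.gdeg_inv_mul g a, ← hρ.mact_eq s _ η h', R.gdeg_inv_mul] at hm
    refine ⟨_, _, hm, ?_, ?_⟩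
    · simp [R.dot_eq, R.ra_eq, R.repPart_repPart_mul, mul_assoc]
    · ext
      simp [R.coe_gdeg, R.coe_tau, R.coe_la, R.ra_eq, R.repPart_repPart_mul, mul_assoc]
  one_mact ξ := by
    induction ξ using induction_xgr with
    | add ξ η h h' => rw [map_add, h, h']
    | hom x ξ h =>
      rw [hρ.mact_eq _ x ξ h, R.ra_eq, R.coe_e, one_mul, R.repPart_subgroup, R.coe_e, map_one,
        Module.End.one_apply]
  mact_mact p t b c g g' κ h h' p' hp' := by
    -- The zero vector lies in every degree, so the degree assumed for `t ▷̄ κ` carries information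
    -- only when `κ ≠ 0`.
    by_cases h0 : κ = 0
    · simp [h0]
    have hx := mem_xgr_of_mem_gr h rfl
    have hx' := mem_xgr_of_mem_gr h' rfl
    rw [hρ.mact_eq p _ _ hx', hρ.mact_eq t _ _ hx, hρ.mact_eq _ _ _ hx, hρ.act_eq]
    rw [hρ.mact_eq t _ _ hx, R.gdeg_inv_mul] at hx'
    -- `ρ` is invertible, so the image of `κ` is nonzero and its degree must be the conjugate of
    -- that of `κ`.
    have h1 := eq_of_mem_xgr hx' (hρ.mem _ _ _ hx) fun h => h0 (by
      simpa [← Module.End.mul_apply, ← map_mul] using congrArg (ρ (R.ra t g : X)⁻¹) h)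
    have h2 : R.repPart (c * R.repPart (t * g)) = R.repPart (t * b) := by
      rw [← R.repPart_coe_inv_mul g', ← mul_assoc, h1]
      simp [R.ra_eq, R.repPart_repPart_mul, mul_assoc]
    -- This yields `p' ◁ (t ▷ |κ|) = p ◁ |t ▷̄ κ|`, which turns the axiom into a product of two
    -- values of `ρ`.
    have h3 : R.tau c (R.ra t g) * (R.tau t b)⁻¹ * R.la t g = g' := by
      ext
      have h4 : (c : X) = g' * (R.ra t g * ((g : X)⁻¹ * b) * (R.ra t g : X)⁻¹) := by
        rw [← h1, mul_inv_cancel_left]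
      simp [R.coe_tau, R.coe_la, R.ra_eq, h2, mul_assoc]
      simp [h4, R.ra_eq, mul_assoc]
    have h5 : R.ra p' (R.la t g) = R.ra p g' := by
      rw [hp', ← R.ra_mul, h3]
    have h6 : R.repPart (R.ra p g' * R.ra t g) = R.ra (R.dot p' t) g := by
      simp [← h5, R.ra_eq, R.dot_eq, R.coe_la, R.repPart_repPart_mul, mul_assoc]
    simp only [R.gdeg_inv_mul, map_mul_apply]
    congr 2
    simp [h5, R.coe_tau, h6]
  cross s a g u η h := by
    have h' := mem_xgr_of_mem_gr h rfl
    have hm := hρ.mem (u : X)⁻¹ _ _ h'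
    rw [← hρ.act_eq] at hm
    rw [hρ.mact_eq _ _ _ h', hρ.mact_eq _ _ _ hm, hρ.act_eq, hρ.act_eq]
    simp only [R.gdeg_inv_mul, map_mul_apply]
    congr 2
    simp [R.coe_la, R.ra_eq, R.coe_gdeg, R.repPart_repPart_mul, mul_assoc,
      R.repPart_coe_inv_mul]

end Data

end Crossed

/-! ### Degrees and action of `X` on tensor products -/

section Tensor

attribute [local instance] LeftCosetReps.fintypeReps LeftCosetReps.fintypeSubgroup

variable {X : Type w} [Group X] {G : Subgroup X} {k : Type u} [Field k]
  {R : LeftCosetReps G}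

/-- The degree `‖ξ ⊗ η‖` when `‖ξ‖ = x` and `‖η‖ = y`. -/
noncomputable def LeftCosetReps.tdeg (R : LeftCosetReps G) (x y : X) : X :=
  (R.gdeg y : X)⁻¹ * x * R.repPart y

theorem LeftCosetReps.tensorGrade_tdeg (R : LeftCosetReps G) (a b : R.M) (g h : G) :
    (((R.tau a b)⁻¹ * g * h : G) : X)⁻¹ * (R.dot a b : X) =
      R.tdeg ((g : X)⁻¹ * a) ((h : X)⁻¹ * b) := by
  simp [tdeg, R.gdeg_inv_mul, R.repPart_inv_mul, R.coe_tau, R.dot_eq, mul_assoc]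

theorem LeftCosetReps.gdeg_tdeg (R : LeftCosetReps G) (x y : X) :
    R.gdeg (R.tdeg x y) = (R.tau (R.repPart x) (R.repPart y))⁻¹ * R.gdeg x * R.gdeg y := by
  conv_lhs => rw [← R.gdeg_inv_mul_repPart x, ← R.gdeg_inv_mul_repPart y, ← R.tensorGrade_tdeg,
    R.gdeg_inv_mul]

theorem LeftCosetReps.repPart_tdeg (R : LeftCosetReps G) (x y : X) :
    R.repPart (R.tdeg x y) = R.dot (R.repPart x) (R.repPart y) := by
  conv_lhs => rw [← R.gdeg_inv_mul_repPart x, ← R.gdeg_inv_mul_repPart y, ← R.tensorGrade_tdeg,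
    R.repPart_inv_mul]

/-- Compatibility of the twisted action on `V ⊗ W` with conjugation of degrees. Here `x` and `z` are
the degrees of the two factors, and `tdeg x z` is `z` multiplied on the left by the conjugate of `x`
by `|η|⁻¹`. -/
theorem LeftCosetReps.conj_tdeg (R : LeftCosetReps G) (x y z : X) :
    y * R.tdeg x z * y⁻¹ = R.tdeg (R.gdeg (y * z * y⁻¹) * y * (R.gdeg z : X)⁻¹ * x *
      (R.gdeg (y * z * y⁻¹) * y * (R.gdeg z : X)⁻¹)⁻¹) (y * z * y⁻¹) := by
  simp [LeftCosetReps.tdeg, R.coe_gdeg, mul_assoc]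

/-- The associator preserves degrees because of this identity. -/
theorem LeftCosetReps.tdeg_tdeg (R : LeftCosetReps G) (x y z : X) :
    R.tdeg (R.tdeg x y) z = R.tdeg ((R.tau (R.repPart y) (R.repPart z) : X)⁻¹ * x *
      (R.tau (R.repPart y) (R.repPart z) : X)⁻¹⁻¹) (R.tdeg y z) := by
  rw [LeftCosetReps.tdeg, LeftCosetReps.tdeg, LeftCosetReps.tdeg, R.gdeg_tdeg, R.repPart_tdeg]
  simp [R.coe_tau, R.dot_eq, mul_assoc]

theorem LeftCosetReps.repPart_conj (R : LeftCosetReps G) (x : X) (h : G) :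
    R.repPart ((h : X)⁻¹ * x * (h : X)⁻¹⁻¹) = R.repPart (x * h) := by
  rw [mul_assoc, R.repPart_coe_inv_mul, inv_inv]

theorem LeftCosetReps.repPart_conj_mul (R : LeftCosetReps G) (x : X) (g h : G) :
    R.repPart ((h : X)⁻¹ * x * (h : X)⁻¹⁻¹ * g) = R.repPart (x * h * g) := by
  rw [← R.repPart_repPart_mul, R.repPart_conj, R.repPart_repPart_mul]

theorem LeftCosetReps.repPart_mul_tau_mul_gdeg (R : LeftCosetReps G) (x y z : X) :
    R.repPart (x * R.tau (R.repPart y) (R.repPart z) * R.gdeg (R.tdeg y z)) =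
      R.repPart (x * R.gdeg y * R.gdeg z) := by
  simp [R.gdeg_tdeg, mul_assoc]

/-- Compares the elements by which the two sides of the pentagon act on the first factor; the other
factors agree without computation. -/
theorem LeftCosetReps.pentagon_rho (R : LeftCosetReps G) (a b : R.M) (y : X) :
    (R.tau (R.dot (R.repPart y) a) b : X)⁻¹ * (R.tau (R.repPart y) a : X)⁻¹ =
      (R.tau (R.repPart ((R.tau a b : X)⁻¹ * y * (R.tau a b : X)⁻¹⁻¹)) (R.dot a b) : X)⁻¹ *
        (R.gdeg ((R.tau a b : X)⁻¹ * y * (R.tau a b : X)⁻¹⁻¹) * (R.tau a b : X)⁻¹ *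
          (R.gdeg y : X)⁻¹) := by
  rw [R.coe_gdeg, R.repPart_conj, R.coe_tau (R.repPart (y * _))]
  simp [R.coe_gdeg, R.coe_tau, R.dot_eq, R.repPart_repPart_mul, mul_assoc]

/-- Compares the actions on the middle factor `η` in the first hexagon. -/
theorem LeftCosetReps.hexagon_forward_rho (R : LeftCosetReps G) (x y z : X) :
    (R.tau (R.repPart (R.repPart (x * R.gdeg y * R.gdeg z) * z *
        (R.repPart (x * R.gdeg y * R.gdeg z) : X)⁻¹)) (R.repPart (x * R.gdeg y * R.gdeg z)) : X)⁻¹ *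
      (R.gdeg (R.repPart (x * R.gdeg y * R.gdeg z) * z *
        (R.repPart (x * R.gdeg y * R.gdeg z) : X)⁻¹) * R.repPart (x * R.gdeg y * R.gdeg z) *
          (R.gdeg z : X)⁻¹) =
      (R.tau (R.repPart (x * R.gdeg y)) (R.repPart z) : X)⁻¹ * R.repPart (x * R.gdeg y) := by
  generalize R.gdeg y = h
  simp [R.coe_tau, R.coe_gdeg, R.repPart_repPart_mul, mul_assoc]

/-- Compares the actions on the first factor `ξ` in the second hexagon. -/
theorem LeftCosetReps.hexagon_reverse_rho (R : LeftCosetReps G) (y z : X) :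
    (R.gdeg ((R.gdeg z : X)⁻¹ * y * (R.gdeg z : X)⁻¹⁻¹) : X) * (R.gdeg z : X)⁻¹ *
        (R.gdeg y : X)⁻¹ * R.tau (R.repPart y) (R.repPart z) =
      (R.gdeg (R.repPart (y * R.gdeg z) * z * (R.repPart (y * R.gdeg z) : X)⁻¹) : X)⁻¹ *
        R.tau (R.repPart (R.repPart (y * R.gdeg z) * z * (R.repPart (y * R.gdeg z) : X)⁻¹))
          (R.repPart (y * R.gdeg z)) := by
  rw [R.coe_gdeg (_ * y * _), R.repPart_conj, R.coe_gdeg (_ * z * _), R.coe_gdeg y, R.coe_tau,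
    R.coe_tau, R.repPart_repPart_mul, R.repPart_repPart_mul, ← R.gdeg_mul z]
  simp [R.repPart_repPart_mul, mul_assoc]

/-- Compares the actions on the last factor `ζ` in the second hexagon. The relation for `ξ` is what
makes the two coset representatives coincide. -/
theorem LeftCosetReps.hexagon_reverse_rho' (R : LeftCosetReps G) (x y z : X) :
    (R.tau (R.repPart (R.gdeg ((R.gdeg z : X)⁻¹ * y * (R.gdeg z : X)⁻¹⁻¹) * (R.gdeg z : X)⁻¹ *
        (R.gdeg y : X)⁻¹ * (R.tau (R.repPart y) (R.repPart z) * x *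
          (R.tau (R.repPart y) (R.repPart z) : X)⁻¹) *
        (R.gdeg ((R.gdeg z : X)⁻¹ * y * (R.gdeg z : X)⁻¹⁻¹) * (R.gdeg z : X)⁻¹ *
          (R.gdeg y : X)⁻¹)⁻¹)) (R.repPart (y * R.gdeg z)) : X) *
      R.repPart (R.tdeg (R.tau (R.repPart y) (R.repPart z) * x *
        (R.tau (R.repPart y) (R.repPart z) : X)⁻¹) y * R.gdeg z) =
    R.repPart (R.tau (R.repPart (R.repPart (y * R.gdeg z) * z *
        (R.repPart (y * R.gdeg z) : X)⁻¹)) (R.repPart (y * R.gdeg z)) * x *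
      (R.tau (R.repPart (R.repPart (y * R.gdeg z) * z * (R.repPart (y * R.gdeg z) : X)⁻¹))
        (R.repPart (y * R.gdeg z)) : X)⁻¹ *
      R.gdeg (R.repPart (y * R.gdeg z) * z * (R.repPart (y * R.gdeg z) : X)⁻¹)) *
      R.repPart (y * R.gdeg z) := by
  have h := R.hexagon_reverse_rho y z
  have hN : (R.gdeg ((R.gdeg z : X)⁻¹ * y * (R.gdeg z : X)⁻¹⁻¹) : X)⁻¹ *
      R.repPart (y * R.gdeg z) = (R.gdeg z : X)⁻¹ * y * R.gdeg z := by
    rw [← R.repPart_conj, R.gdeg_inv_mul_repPart, inv_inv]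
  have hy := R.gdeg_mul y
  rw [LeftCosetReps.tdeg, ← hy]
  -- Only `h` and `hN` relate these elements of `G`; once they are opaque, `repPart` can absorb them
  -- on the left.
  generalize R.tau (R.repPart y) (R.repPart z) = t at *
  generalize R.tau (R.repPart (R.repPart (y * R.gdeg z) * z *
    (R.repPart (y * R.gdeg z) : X)⁻¹)) (R.repPart (y * R.gdeg z)) = t' at *
  generalize R.gdeg (R.repPart (y * R.gdeg z) * z * (R.repPart (y * R.gdeg z) : X)⁻¹) = g at *
  generalize R.gdeg ((R.gdeg z : X)⁻¹ * y * (R.gdeg z : X)⁻¹⁻¹) = g' at *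
  generalize R.gdeg z = c at *
  generalize R.gdeg y = b at *
  have h' : (t' : X)⁻¹ * g = (t : X)⁻¹ * (b * (c * (g' : X)⁻¹)) := by
    simpa [mul_assoc] using (congrArg (·⁻¹) h).symm
  rw [R.coe_tau]
  simp [R.repPart_repPart_mul, R.repPart_coe_mul, R.repPart_coe_inv_mul, mul_assoc, hN, h']

theorem LeftCosetReps.braid_tdeg (R : LeftCosetReps G) (x y : X) :
    R.tdeg x y = R.tdeg (R.repPart (x * R.gdeg y) * y * (R.repPart (x * R.gdeg y) : X)⁻¹)
      ((R.gdeg y : X)⁻¹ * x * (R.gdeg y : X)⁻¹⁻¹) := by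
  have hy := R.gdeg_mul y
  rw [LeftCosetReps.tdeg, LeftCosetReps.tdeg, ← hy]
  generalize R.gdeg y = h
  rw [R.coe_gdeg, R.repPart_conj]
  simp [mul_assoc]

/-- Equivariance of the braiding on the factor `η`. For `ξ` the corresponding elements cancel
formally. -/
theorem LeftCosetReps.braid_rho (R : LeftCosetReps G) (x y : X) (u h : G) :
    (R.repPart (u * y * (h : X)⁻¹ * x * (u * y * (h : X)⁻¹)⁻¹ * u) : X) * y =
      R.gdeg (y * ((h : X)⁻¹ * x * (h : X)⁻¹⁻¹) * y⁻¹) * y *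
        (R.gdeg ((h : X)⁻¹ * x * (h : X)⁻¹⁻¹) : X)⁻¹ * R.repPart (x * h) := by
  rw [R.coe_gdeg, R.coe_gdeg, R.repPart_conj]
  simp [mul_assoc, R.repPart_coe_mul]

variable [Finite X]

namespace Data

theorem mproj_of_mem (V : Data k R) {a : R.M} {g : G} {ξ : V} (h : ξ ∈ V.gr a g) :
    V.mproj a ξ = ξ := by
  classical
  rw [mproj, LinearMap.sum_apply, Finset.sum_eq_single g]
  · rw [V.proj_of_mem _ (a, g) ξ h, if_pos rfl]
  · intro b _ hb
    rw [V.proj_of_mem _ (a, g) ξ h, if_neg]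
    simpa using hb
  · simp

theorem mproj_of_mem_of_ne (V : Data k R) {a b : R.M} {g : G} {ξ : V} (h : ξ ∈ V.gr a g)
    (hb : b ≠ a) : V.mproj b ξ = 0 := by
  classical
  rw [mproj, LinearMap.sum_apply]
  refine Finset.sum_eq_zero fun c _ => ?_
  rw [V.proj_of_mem _ (a, g) ξ h, if_neg]
  simp [hb]

theorem tensorAct_tmul (V W : Data k R) (u : G) (ξ : V) {b : R.M} {h : G} {η : W}
    (hη : η ∈ W.gr b h) :
    (V.tensor W).act u (tmul ξ η) = tmul (V.act (R.la b u) ξ) (W.act u η) := by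
  change V.tensorAct W u (ξ ⊗ₜ[k] η) = V.act (R.la b u) ξ ⊗ₜ[k] W.act u η
  rw [tensorAct, LinearMap.sum_apply]
  rw [Finset.sum_eq_single b]
  · rw [TensorProduct.map_tmul, LinearMap.comp_apply, W.mproj_of_mem hη]
  · intro c _ hc
    rw [TensorProduct.map_tmul, LinearMap.comp_apply, W.mproj_of_mem_of_ne hη hc, map_zero,
      tmul_zero]
  · simp

theorem tensorMact_tmul (V W : Data k R) (s : R.M) {a b c : R.M} {g h h' : G} {ξ : V} {η : W}
    (hξ : ξ ∈ V.gr a g) (hη : η ∈ W.gr b h) (hc : W.mact (R.ra s g) η ∈ W.gr c h') :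
    (V.tensor W).mact (R.ra s (R.tau a b)) (tmul ξ η) =
      tmul (V.act (R.tau (R.ra s g) b * (R.tau c (R.ra s (g * h)))⁻¹) (V.mact s ξ))
        (W.mact (R.ra s g) η) := by
  classical
  change V.tensorMact W (R.ra s (R.tau a b)) (ξ ⊗ₜ[k] η) =
    V.act (R.tau (R.ra s g) b * (R.tau c (R.ra s (g * h)))⁻¹) (V.mact s ξ) ⊗ₜ[k]
      W.mact (R.ra s g) η
  rw [tensorMact, LinearMap.sum_apply]
  rw [Finset.sum_eq_single (a, g)]
  rotate_left
  · intro i _ hi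
    simp [LinearMap.sum_apply, V.proj_of_mem _ (a, g) ξ hξ, hi]
  · simp
  rw [LinearMap.sum_apply, Finset.sum_eq_single (b, h)]
  rotate_left
  · intro j _ hj
    simp [LinearMap.sum_apply, W.proj_of_mem _ (b, h) η hη, hj]
  · simp
  simp only [← R.ra_mul, mul_inv_cancel, R.ra_one]
  rw [LinearMap.sum_apply, Finset.sum_eq_single c]
  rotate_left
  · intro d _ hd
    simp [W.proj_of_mem _ (b, h) η hη, W.mproj_of_mem_of_ne hc hd]
  · simp
  simp [V.proj_of_mem _ (a, g) ξ hξ, W.proj_of_mem _ (b, h) η hη, W.mproj_of_mem hc]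

theorem tmul_mem_xgr {V W : Data k R} {x y : X} {ξ : V} {η : W} (hξ : ξ ∈ V.xgr x)
    (hη : η ∈ W.xgr y) : tmul ξ η ∈ (V.tensor W).xgr (R.tdeg x y) := by
  rw [xgr, R.gdeg_tdeg, R.repPart_tdeg]
  change ξ ⊗ₜ[k] η ∈ tensorGr V W _ _
  exact Submodule.mem_iSup_of_mem (R.repPart x, R.gdeg x) <|
    Submodule.mem_iSup_of_mem (R.repPart y, R.gdeg y) <|
    Submodule.mem_iSup_of_mem rfl <| Submodule.apply_mem_map₂ _ hξ hη

theorem tensor_xgr_le {V W : Data k R} {d : X} {S : Submodule k (V.tensor W)}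
    (h : ∀ x y, R.tdeg x y = d → ∀ ξ ∈ V.xgr x, ∀ η ∈ W.xgr y, tmul ξ η ∈ S) :
    (V.tensor W).xgr d ≤ S := by
  refine iSup_le fun i => iSup_le fun j => iSup_le fun hij => ?_
  refine Submodule.map₂_le.2 fun v hv w hw => ?_
  refine h _ _ ?_ v (mem_xgr_of_mem_gr hv rfl) w (mem_xgr_of_mem_gr hw rfl)
  rw [← R.tensorGrade_tdeg, ← R.gdeg_inv_mul_repPart d]
  simp only [tensorGrade, Prod.mk.injEq] at hij
  rw [hij.1, hij.2]

/-- The action of `y ∈ X` on `V ⊗ W`. -/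
noncomputable def tensorRhoFun (V W : Data k R) (ρ : X →* Module.End k V)
    (σ : X →* Module.End k W) (y : X) : Module.End k (V.tensor W) :=
  V.glue₂ W fun _ z => tmul.compl₁₂
    (ρ (R.gdeg (y * z * y⁻¹) * y * (R.gdeg z : X)⁻¹)) (σ y)

/-- The twist depends only on the degree of `η`, so `ξ` need not be homogeneous. -/
theorem tensorRhoFun_tmul (V W : Data k R) (ρ : X →* Module.End k V)
    (σ : X →* Module.End k W) (y : X) {z : X} (ξ : V) {η : W} (hη : η ∈ W.xgr z) :
    V.tensorRhoFun W ρ σ y (tmul ξ η) =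
      tmul (ρ (R.gdeg (y * z * y⁻¹) * y * (R.gdeg z : X)⁻¹) ξ) (σ y η) := by
  induction ξ using induction_xgr with
  | add ξ ξ' h h' => simp only [map_add, LinearMap.add_apply, h, h']
  | hom x ξ h => exact glue₂_apply V W _ h hη

/-- The action of `X` on `V ⊗ W`. -/
noncomputable def IsCrossed.tensorRho {V W : Data k R} {ρ : X →* Module.End k V}
    {σ : X →* Module.End k W} (_hρ : V.IsCrossed ρ) (hσ : W.IsCrossed σ) :
    X →* Module.End k (V.tensor W) where
  toFun := V.tensorRhoFun W ρ σ
  map_one' := by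
    refine tensor_ext fun x y ξ _ η hη => ?_
    rw [tensorRhoFun_tmul V W _ _ _ _ hη]
    simp
  map_mul' y z := by
    refine tensor_ext fun x d ξ _ η hη => ?_
    rw [tensorRhoFun_tmul V W _ _ _ _ hη]
    rw [Module.End.mul_apply, tensorRhoFun_tmul V W _ _ _ _ hη, tensorRhoFun_tmul V W _ _ _ _ (hσ.mem z d η hη), map_mul_apply, map_mul_apply]
    -- The twists telescope: the inner `|ση|` for `z` cancels against its inverse in the twist for
    -- `y`.
    simp [mul_assoc]

theorem IsCrossed.tensor {V W : Data k R} {ρ : X →* Module.End k V} {σ : X →* Module.End k W}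
    (hρ : V.IsCrossed ρ) (hσ : W.IsCrossed σ) : (V.tensor W).IsCrossed (hρ.tensorRho hσ) where
  act_eq u := by
    refine LinearMap.congr_fun (tensor_ext fun x y ξ _ η hη => ?_)
    refine (tensorAct_tmul V W u ξ hη).trans
      (Eq.trans ?_ (tensorRhoFun_tmul V W ρ σ _ ξ hη).symm)
    rw [hρ.act_eq, hσ.act_eq]
    congr 3
    simp [R.coe_la, R.coe_gdeg, mul_assoc, R.repPart_coe_inv_mul, R.repPart_repPart_mul]
  mact_eq t d := by
    change _ ≤ LinearMap.eqLocus ((V.tensor W).mact t) (hρ.tensorRho hσ (R.ra t (R.gdeg d)))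
    refine tensor_xgr_le (S := LinearMap.eqLocus _ _) fun x y hd ξ hξ η hη => ?_
    subst hd
    rw [LinearMap.mem_eqLocus]
    -- Right translation by `τ` permutes `M`, so every `t` has the form `s ◁ τ(⟨ξ⟩,⟨η⟩)` in which
    -- the action on `V ⊗ W` is prescribed.
    have ht : t = R.ra (R.ra t (R.tau (R.repPart x) (R.repPart y))⁻¹)
      (R.tau (R.repPart x) (R.repPart y)) := by
      rw [← R.ra_mul, inv_mul_cancel, R.ra_one]
    generalize R.ra t (R.tau (R.repPart x) (R.repPart y))⁻¹ = s at ht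
    subst ht
    have hm := hσ.mem (R.ra (R.ra s (R.gdeg x)) (R.gdeg y)) _ _ hη
    rw [← hσ.mact_eq _ _ _ hη] at hm
    refine (tensorMact_tmul V W s hξ hη hm).trans
      (Eq.trans ?_ (tensorRhoFun_tmul V W ρ σ _ ξ hη).symm)
    rw [hρ.mact_eq _ _ _ hξ, hσ.mact_eq _ _ _ hη, hρ.act_eq, map_mul_apply, R.gdeg_tdeg]
    congr 3
    · simp [R.coe_tau, R.ra_eq, R.coe_gdeg, mul_assoc, R.repPart_repPart_mul]
    · simp [← R.ra_mul, mul_assoc]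
  mem y d := by
    change (V.tensor W).xgr d ≤
      Submodule.comap (hρ.tensorRho hσ y) ((V.tensor W).xgr (y * d * y⁻¹))
    refine tensor_xgr_le (S := Submodule.comap _ _) fun x z hd ξ hξ η hη => ?_
    subst hd
    have := tmul_mem_xgr (hρ.mem (R.gdeg (y * z * y⁻¹) * y * (R.gdeg z : X)⁻¹) _ _ hξ)
      (hσ.mem y _ _ hη)
    rw [← tensorRhoFun_tmul V W ρ σ y ξ hη] at this
    rw [← R.conj_tdeg] at this
    exact this

theorem unit_isCrossed (k : Type u) [Field k] (R : LeftCosetReps G) :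
    (Data.unit k R).IsCrossed 1 where
  act_eq _ _ := rfl
  mact_eq _ _ _ _ := rfl
  mem y x ξ h := by
    -- The unit object is concentrated in degree `1`, which conjugation fixes.
    by_cases hx : R.repPart x = R.e ∧ R.gdeg x = 1
    · have : x = 1 := by
        rw [← R.gdeg_inv_mul_repPart x, hx.1, hx.2]
        simp [R.coe_e]
      subst this
      simpa using h
    · have h' : ξ = 0 := by
        simp only [xgr, unit, if_neg hx] at h
        exact h
      rw [h', map_zero]
      exact zero_mem _

end Data

end Tensor

/-! ### Extensionality on iterated tensors; the associator and braiding as linear maps -/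

section LinearMaps

variable {X : Type w} [Group X] [Finite X] {G : Subgroup X} {k : Type u} [Field k]
  {R : LeftCosetReps G}

namespace Data

theorem tensor_ext_left {V W : Data k R} {Z : Type*} [AddCommGroup Z] [Module k Z]
    {f g : V.tensor W →ₗ[k] Z}
    (h : ∀ y, ∀ η ∈ W.xgr y, f ∘ₗ tmul.flip η = g ∘ₗ tmul.flip η) : f = g :=
  tensor_ext fun _ y ξ _ η hη => LinearMap.congr_fun (h y η hη) ξ

theorem tensor_ext₃ {U V W : Data k R} {Z : Type*} [AddCommGroup Z] [Module k Z]
    {f g : (U.tensor V).tensor W →ₗ[k] Z}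
    (h : ∀ x y z, ∀ ξ ∈ U.xgr x, ∀ η ∈ V.xgr y, ∀ ζ ∈ W.xgr z,
      f (tmul (tmul ξ η) ζ) = g (tmul (tmul ξ η) ζ)) : f = g :=
  tensor_ext_left fun z ζ hζ => tensor_ext fun x y ξ hξ η hη => h x y z ξ hξ η hη ζ hζ

theorem tensor_ext₃' {U V W : Data k R} {Z : Type*} [AddCommGroup Z] [Module k Z]
    {f g : U.tensor (V.tensor W) →ₗ[k] Z}
    (h : ∀ x y z, ∀ ξ ∈ U.xgr x, ∀ η ∈ V.xgr y, ∀ ζ ∈ W.xgr z,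
      f (tmul ξ (tmul η ζ)) = g (tmul ξ (tmul η ζ))) : f = g := by
  have : ∀ x, ∀ ξ ∈ U.xgr x, f ∘ₗ tmul ξ = g ∘ₗ tmul ξ := fun x ξ hξ =>
    tensor_ext fun y z η hη ζ hζ => h x y z ξ hξ η hη ζ hζ
  exact tensor_ext fun x _ ξ hξ η _ => LinearMap.congr_fun (this x ξ hξ) η

theorem finrank_tensor (V W : Data k R) :
    Module.finrank k (V.tensor W) = Module.finrank k V * Module.finrank k W :=
  Module.finrank_tensorProduct (R := k) (S := k) (M := V) (M' := W)

/-- The linear map `f ⊗ g`. -/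
noncomputable def tensorMap {V V' W W' : Data k R} (f : V →ₗ[k] V') (g : W →ₗ[k] W') :
    V.tensor W →ₗ[k] V'.tensor W' := TensorProduct.map f g

theorem tensorMap_tmul {V V' W W' : Data k R} (f : V →ₗ[k] V') (g : W →ₗ[k] W') (ξ : V) (η : W) :
    tensorMap f g (tmul ξ η) = tmul (f ξ) (g η) := rfl

/-- The linear map underlying the associator. -/
noncomputable def assocLin (U V W : Data k R) :
    (U.tensor V).tensor W →ₗ[k] U.tensor (V.tensor W) :=
  (TensorProduct.lift (M := U) (N := V.tensor W) (LinearMap.flip <| V.glue₂ W fun y z =>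
    tmul.compr₂ (tmul ∘ₗ U.act (R.tau (R.repPart y) (R.repPart z))).flip)) ∘ₗ
    (TensorProduct.assoc k U V W).toLinearMap

theorem assocLin_tmul (U V W : Data k R) {y z : X} (ξ : U) {η : V} {ζ : W} (hη : η ∈ V.xgr y)
    (hζ : ζ ∈ W.xgr z) : assocLin U V W (tmul (tmul ξ η) ζ) =
      tmul (U.act (R.tau (R.repPart y) (R.repPart z)) ξ) (tmul η ζ) :=
  LinearMap.congr_fun (glue₂_apply V W (fun y z => tmul.compr₂
    (tmul ∘ₗ U.act (R.tau (R.repPart y) (R.repPart z))).flip) hη hζ) ξ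

/-- The linear map underlying the braiding. -/
noncomputable def braidLin (V W : Data k R) : V.tensor W →ₗ[k] W.tensor V :=
  V.glue₂ W fun x y => (tmul.compl₁₂ (W.mact (R.repPart x)) (V.act (R.gdeg y))).flip

theorem braidLin_tmul (V W : Data k R) {x y : X} {ξ : V} {η : W} (hξ : ξ ∈ V.xgr x)
    (hη : η ∈ W.xgr y) :
    braidLin V W (tmul ξ η) = tmul (W.mact (R.repPart x) η) (V.act (R.gdeg y) ξ) :=
  glue₂_apply V W _ hξ hη

end Data

end LinearMaps

/-! ### Structure morphisms of `𝒟` in terms of `ρ` -/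

namespace D

open Data

variable {X : Type w} [Group X] {G : Subgroup X} {k : Type u} [Field k]
  {R : LeftCosetReps G}

theorem linear_mem {V W : D k R} (f : V ⟶ W) {x : X} {ξ : V} (h : ξ ∈ V.data.xgr x) :
    linear f ξ ∈ W.data.xgr x := Hom.map_gr f _ _ ξ h

theorem hom_ext {V W : D k R} {f g : V ⟶ W} (h : linear f = linear g) : f = g := Hom.ext h

theorem linear_comp {U V W : D k R} (f : U ⟶ V) (g : V ⟶ W) (ξ : U) :
    linear (f ≫ g) ξ = linear g (linear f ξ) := rfl

theorem linear_id (V : D k R) (ξ : V) : linear (𝟙 V) ξ = ξ := rfl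

variable [Finite X]

/-- The action of `X` on an object. -/
noncomputable def rho (V : D k R) : X →* Module.End k V := V.isObject.rho

theorem isCrossed (V : D k R) : V.data.IsCrossed V.rho := V.isObject.isCrossed

theorem rho_rho (V : D k R) (x y : X) (ξ : V) : V.rho x (V.rho y ξ) = V.rho (x * y) ξ :=
  IsCrossed.map_mul_apply x y ξ

theorem rho_mem (V : D k R) (y : X) {x : X} {ξ : V} (h : ξ ∈ V.data.xgr x) :
    V.rho y ξ ∈ V.data.xgr (y * x * y⁻¹) := V.isCrossed.mem y x ξ h

/-- The tensor product of objects. -/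
@[reducible] noncomputable def tensor (V W : D k R) : D k R :=
  ⟨V.data.tensor W.data, (V.isCrossed.tensor W.isCrossed).isObject⟩

/-- The unit object. -/
@[reducible] noncomputable def unit (k : Type u) [Field k] (R : LeftCosetReps G) : D k R :=
  ⟨Data.unit k R, (unit_isCrossed k R).isObject⟩

theorem rho_tmul (V W : D k R) (y : X) {z : X} (ξ : V) {η : W} (hη : η ∈ W.data.xgr z) :
    (V.tensor W).rho y (tmul ξ η) =
      tmul (V.rho (R.gdeg (y * z * y⁻¹) * y * (R.gdeg z : X)⁻¹) ξ) (W.rho y η) := by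
  refine Eq.trans (LinearMap.congr_fun ?_ _) (tensorRhoFun_tmul V.data W.data V.rho W.rho y ξ hη)
  exact ((V.isCrossed.tensor W.isCrossed).apply_eq_rhoFun y).symm

theorem rho_unit (y : X) (c : unit k R) : (unit k R).rho y c = c :=
  LinearMap.congr_fun ((unit_isCrossed k R).apply_eq_rhoFun y).symm c

/-- On homogeneous elements `ρ(y)` is a composite of actions of `G` and `M` chosen by the degree
alone, and a morphism preserves all of these. -/
theorem linear_rho {V W : D k R} (f : V ⟶ W) (y : X) (ξ : V) :
    linear f (V.rho y ξ) = W.rho y (linear f ξ) := by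
  induction ξ using induction_xgr with
  | add ξ η h h' => simp only [map_add, h, h']
  | hom x ξ h =>
    refine (congrArg (linear f) (rhoFun_apply V.data y h)).trans
      (Eq.trans ?_ (rhoFun_apply W.data y (linear_mem f h)).symm)
    exact (Hom.map_act f _ _).trans (congrArg _ (Hom.map_mact f _ _))

/-- A linear map preserving the grading by `X` and commuting with the action of `X` is a
morphism. -/
def homOf {V W : D k R} (f : V →ₗ[k] W) (hgr : ∀ x, ∀ ξ ∈ V.data.xgr x, f ξ ∈ W.data.xgr x)
    (hrho : ∀ y, f ∘ₗ V.rho y = W.rho y ∘ₗ f) : V ⟶ W :=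
  Hom.mk f
    (fun s u ξ h => mem_gr_of_mem_xgr (hgr _ ξ (mem_xgr_of_mem_gr h rfl)) rfl)
    (fun u ξ => by
      rw [V.isCrossed.act_eq, W.isCrossed.act_eq]
      exact LinearMap.congr_fun (hrho _) ξ)
    (fun t ξ => by
      induction ξ using induction_xgr with
      | add ξ η h h' => simp only [map_add, h, h']
      | hom x ξ h =>
        rw [V.isCrossed.mact_eq t x ξ h, W.isCrossed.mact_eq t x _ (hgr x ξ h)]
        exact LinearMap.congr_fun (hrho _) ξ)

/-- A bijection preserving degrees commutes with the homogeneous projections, hence so does its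
inverse. -/
theorem symm_mem {V W : D k R} (e : V ≃ₗ[k] W)
    (hgr : ∀ x, ∀ ξ ∈ V.data.xgr x, e ξ ∈ W.data.xgr x) (x : X) (η : W) (h : η ∈ W.data.xgr x) :
    e.symm η ∈ V.data.xgr x := by
  classical
  have h1 : e.toLinearMap ∘ₗ V.data.proj (R.repPart x, R.gdeg x) =
      W.data.proj (R.repPart x, R.gdeg x) ∘ₗ e.toLinearMap := by
    refine lin_ext fun y ξ hξ => ?_
    simp only [LinearMap.comp_apply, LinearEquiv.coe_coe]
    rw [V.data.proj_of_mem _ (R.repPart y, R.gdeg y) ξ hξ,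
      W.data.proj_of_mem _ (R.repPart y, R.gdeg y) _ (hgr y ξ hξ)]
    split_ifs <;> simp
  have h2 := LinearMap.congr_fun h1 (e.symm η)
  simp only [LinearMap.comp_apply, LinearEquiv.coe_coe, LinearEquiv.apply_symm_apply] at h2
  rw [W.data.proj_of_mem _ (R.repPart x, R.gdeg x) η h, if_pos rfl,
    ← LinearEquiv.eq_symm_apply] at h2
  rw [← h2]
  exact V.data.proj_mem (R.repPart x, R.gdeg x) _

/-- A linear equivalence preserving the grading by `X` and commuting with the action of `X` is an
isomorphism. -/
def isoOf {V W : D k R} (e : V ≃ₗ[k] W) (hgr : ∀ x, ∀ ξ ∈ V.data.xgr x, e ξ ∈ W.data.xgr x)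
    (hrho : ∀ y, e.toLinearMap ∘ₗ V.rho y = W.rho y ∘ₗ e.toLinearMap) : V ≅ W where
  hom := homOf e.toLinearMap hgr hrho
  inv := homOf e.symm.toLinearMap (symm_mem e hgr) fun y => by
    ext η
    have := LinearMap.congr_fun (hrho y) (e.symm η)
    simp only [LinearMap.comp_apply, LinearEquiv.coe_coe, LinearEquiv.apply_symm_apply] at this ⊢
    rw [← this, LinearEquiv.symm_apply_apply]
  hom_inv_id := hom_ext (LinearMap.ext e.symm_apply_apply)
  inv_hom_id := hom_ext (LinearMap.ext e.apply_symm_apply)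

/-- The tensor product of morphisms. -/
noncomputable def tensorHom {V V' W W' : D k R} (θ : V ⟶ V') (φ : W ⟶ W') :
    V.tensor W ⟶ V'.tensor W' :=
  homOf (V := V.tensor W) (W := V'.tensor W') (tensorMap (linear θ) (linear φ))
    (fun d => by
      change (V.tensor W).data.xgr d ≤ Submodule.comap (tensorMap (linear θ) (linear φ))
        ((V'.tensor W').data.xgr d)
      refine tensor_xgr_le fun x y hd ξ hξ η hη => ?_
      subst hd
      exact tmul_mem_xgr (linear_mem θ hξ) (linear_mem φ hη))
    (fun y => by
      refine tensor_ext fun x z ξ hξ η hη => ?_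
      rw [LinearMap.comp_apply, LinearMap.comp_apply, rho_tmul V W y ξ hη, tensorMap_tmul,
        tensorMap_tmul, rho_tmul V' W' y _ (linear_mem φ hη), linear_rho, linear_rho])

theorem tensorHom_tmul {V V' W W' : D k R} (θ : V ⟶ V') (φ : W ⟶ W') (ξ : V) (η : W) :
    linear (tensorHom θ φ) (tmul ξ η) = tmul (linear θ ξ) (linear φ η) := rfl

theorem assocLin_tmul_rho (U V W : D k R) {y z : X} (ξ : U) {η : V} {ζ : W}
    (hη : η ∈ V.data.xgr y) (hζ : ζ ∈ W.data.xgr z) :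
    assocLin U.data V.data W.data (tmul (tmul ξ η) ζ) =
      tmul (U.rho (R.tau (R.repPart y) (R.repPart z) : X)⁻¹ ξ) (tmul η ζ) := by
  rw [assocLin_tmul _ _ _ ξ hη hζ, U.isCrossed.act_eq]

theorem assocLin_surjective (U V W : D k R) :
    Function.Surjective (assocLin U.data V.data W.data) := by
  -- Surjectivity is restated as vanishing of the quotient map by the range, which can be tested on
  -- homogeneous tensors. Injectivity later follows by equality of dimensions.
  rw [← LinearMap.range_eq_top, ← Submodule.ker_mkQ (LinearMap.range _), LinearMap.ker_eq_top]
  refine tensor_ext₃' fun x y z ξ _ η hη ζ hζ => ?_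
  rw [LinearMap.zero_apply, Submodule.mkQ_apply, Submodule.Quotient.mk_eq_zero]
  refine ⟨tmul (tmul (U.rho (R.tau (R.repPart y) (R.repPart z)) ξ) η) ζ, ?_⟩
  rw [assocLin_tmul_rho U V W _ hη hζ, rho_rho, inv_mul_cancel, map_one, Module.End.one_apply]

/-- The linear equivalence underlying the associator. -/
noncomputable def assocEquiv (U V W : D k R) :
    (U.data.tensor V.data).tensor W.data ≃ₗ[k] U.data.tensor (V.data.tensor W.data) :=
  LinearEquiv.ofBijective (assocLin U.data V.data W.data)
    ⟨(LinearMap.injective_iff_surjective_of_finrank_eq_finrank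
      (by simp only [finrank_tensor, mul_assoc])).2 (assocLin_surjective U V W),
      assocLin_surjective U V W⟩

/-- The associator. -/
noncomputable def associator (U V W : D k R) :
    (U.tensor V).tensor W ≅ U.tensor (V.tensor W) :=
  isoOf (V := (U.tensor V).tensor W) (W := U.tensor (V.tensor W)) (assocEquiv U V W)
    (fun d => by
      change ((U.tensor V).tensor W).data.xgr d ≤ Submodule.comap
        (assocLin U.data V.data W.data) ((U.tensor (V.tensor W)).data.xgr d)
      refine tensor_xgr_le fun x z hd ξ hξ ζ hζ => ?_
      subst hd
      -- For fixed `ζ` the condition on `ξ` defines a submodule, so an arbitrary homogeneous element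
      -- of `U ⊗ V` may be replaced by a pure tensor.
      change ξ ∈ Submodule.comap (tmul.flip ζ) (Submodule.comap (assocLin U.data V.data W.data)
        ((U.tensor (V.tensor W)).data.xgr (R.tdeg x z)))
      refine tensor_xgr_le (V := U.data) (W := V.data) (fun x y hd ξ hξ' η hη => ?_) hξ
      subst hd
      change assocLin U.data V.data W.data (tmul (tmul ξ η) ζ) ∈
        ((U.tensor (V.tensor W)).data.xgr (R.tdeg (R.tdeg x y) z))
      rw [assocLin_tmul_rho U V W ξ hη hζ, R.tdeg_tdeg]
      exact tmul_mem_xgr (U.rho_mem _ hξ') (tmul_mem_xgr hη hζ))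
    (fun y => by
      refine tensor_ext₃ fun x w z ξ hξ η hη ζ hζ => ?_
      change assocLin U.data V.data W.data (((U.tensor V).tensor W).rho y (tmul (tmul ξ η) ζ)) =
        (U.tensor (V.tensor W)).rho y (assocLin U.data V.data W.data (tmul (tmul ξ η) ζ))
      rw [assocLin_tmul_rho U V W ξ hη hζ, rho_tmul (U.tensor V) W y _ hζ, rho_tmul U V _ ξ hη,
        rho_tmul U (V.tensor W) y _ (tmul_mem_xgr hη hζ), rho_tmul V W y η hζ,
        assocLin_tmul_rho U V W _ (V.rho_mem _ hη) (W.rho_mem _ hζ), rho_rho, rho_rho,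
        R.conj_tdeg, R.gdeg_tdeg, R.gdeg_tdeg]
      congr 3
      simp [mul_assoc])

theorem associator_tmul (U V W : D k R) {y z : X} (ξ : U) {η : V} {ζ : W}
    (hη : η ∈ V.data.xgr y) (hζ : ζ ∈ W.data.xgr z) :
    linear (associator U V W).hom (tmul (tmul ξ η) ζ) =
      tmul (U.rho (R.tau (R.repPart y) (R.repPart z) : X)⁻¹ ξ) (tmul η ζ) :=
  assocLin_tmul_rho U V W ξ hη hζ

theorem braidLin_tmul_rho (V W : D k R) {x y : X} {ξ : V} {η : W} (hξ : ξ ∈ V.data.xgr x)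
    (hη : η ∈ W.data.xgr y) : braidLin V.data W.data (tmul ξ η) =
      tmul (W.rho (R.repPart (x * R.gdeg y) : X) η) (V.rho (R.gdeg y : X)⁻¹ ξ) := by
  rw [braidLin_tmul _ _ hξ hη, V.isCrossed.act_eq, W.isCrossed.mact_eq _ _ _ hη, R.ra_eq,
    R.repPart_repPart_mul]

theorem braidLin_surjective (V W : D k R) : Function.Surjective (braidLin V.data W.data) := by
  rw [← LinearMap.range_eq_top, ← Submodule.ker_mkQ (LinearMap.range _), LinearMap.ker_eq_top]
  refine tensor_ext fun x y ξ hξ η hη => ?_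
  rw [LinearMap.zero_apply, Submodule.mkQ_apply, Submodule.Quotient.mk_eq_zero]
  have h1 := W.rho_mem (R.repPart y : X)⁻¹ hξ
  -- The preimage undoes `ρ(⟨η⟩)` on `ξ` first; the degree this leaves on that factor dictates the
  -- element of `G` to be undone on `η`. The latter keeps the coset representative of `y` that the
  -- braiding uses.
  refine ⟨tmul (V.rho (R.gdeg ((R.repPart y : X)⁻¹ * x * (R.repPart y : X)⁻¹⁻¹)) η)
    (W.rho (R.repPart y : X)⁻¹ ξ), ?_⟩
  rw [braidLin_tmul_rho V W (V.rho_mem _ hη) h1, rho_rho, rho_rho, inv_mul_cancel, map_one,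
    Module.End.one_apply, inv_mul_cancel_right, R.repPart_coe_mul, mul_inv_cancel, map_one,
    Module.End.one_apply]

/-- The linear equivalence underlying the braiding. -/
noncomputable def braidEquiv (V W : D k R) :
    V.data.tensor W.data ≃ₗ[k] W.data.tensor V.data :=
  LinearEquiv.ofBijective (braidLin V.data W.data)
    ⟨(LinearMap.injective_iff_surjective_of_finrank_eq_finrank
      (by simp only [finrank_tensor, mul_comm])).2 (braidLin_surjective V W),
      braidLin_surjective V W⟩

/-- The braiding. -/
noncomputable def braiding (V W : D k R) : V.tensor W ≅ W.tensor V :=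
  isoOf (V := V.tensor W) (W := W.tensor V) (braidEquiv V W)
    (fun d => by
      change (V.tensor W).data.xgr d ≤ Submodule.comap (braidLin V.data W.data)
        ((W.tensor V).data.xgr d)
      refine tensor_xgr_le fun x y hd ξ hξ η hη => ?_
      subst hd
      rw [Submodule.mem_comap, braidLin_tmul_rho V W hξ hη]
      convert tmul_mem_xgr (W.rho_mem _ hη) (V.rho_mem _ hξ) using 2
      exact R.braid_tdeg x y)
    (fun y => by
      refine tensor_ext fun x z ξ hξ η hη => ?_
      change braidLin V.data W.data ((V.tensor W).rho y (tmul ξ η)) =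
        (W.tensor V).rho y (braidLin V.data W.data (tmul ξ η))
      rw [braidLin_tmul_rho V W hξ hη, rho_tmul V W y _ hη,
        braidLin_tmul_rho V W (V.rho_mem _ hξ) (W.rho_mem _ hη),
        rho_tmul W V y _ (V.rho_mem _ hξ)]
      simp only [rho_rho]
      refine congrArg₂ (fun a b => tmul (W.rho a η) (V.rho b ξ)) ?_ ?_
      · exact R.braid_rho x y _ _
      · simp [mul_assoc])

theorem braiding_tmul (V W : D k R) {x y : X} {ξ : V} {η : W} (hξ : ξ ∈ V.data.xgr x)
    (hη : η ∈ W.data.xgr y) : linear (braiding V W).hom (tmul ξ η) =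
      tmul (W.rho (R.repPart (x * R.gdeg y) : X) η) (V.rho (R.gdeg y : X)⁻¹ ξ) :=
  braidLin_tmul_rho V W hξ hη

end D

/-! ### Naturality, pentagon, triangle and hexagons -/

namespace D

open Data

variable {X : Type w} [Group X] [Finite X] {G : Subgroup X} {k : Type u} [Field k]
  {R : LeftCosetReps G}

/-- The element `1` of the unit object. -/
def one (k : Type u) [Field k] (R : LeftCosetReps G) : Data.unit k R := (1 : k)

theorem one_mem_xgr (k : Type u) [Field k] (R : LeftCosetReps G) :
    one k R ∈ (Data.unit k R).xgr 1 := by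
  have h : (Data.unit k R).xgr 1 = ⊤ := if_pos ⟨R.repPart_one, R.gdeg_one⟩
  rw [h]
  trivial

theorem eq_smul_one (c : Data.unit k R) : ∃ r : k, c = r • one k R :=
  ⟨c, (mul_one (M := k) c).symm⟩

/-- The isomorphism `ξ ↦ ξ ⊗ 1`. -/
noncomputable def rightUnit (V : D k R) : V ≅ V.tensor (unit k R) :=
  isoOf (W := V.tensor (unit k R)) (TensorProduct.rid k V).symm
    (fun x ξ h => by
      have := tmul_mem_xgr h (one_mem_xgr k R)
      simp only [LeftCosetReps.tdeg, R.gdeg_one, R.repPart_one, R.coe_e, OneMemClass.coe_one,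
        inv_one, one_mul, mul_one] at this
      exact this)
    (fun y => by
      ext ξ
      refine Eq.trans ?_ (rho_tmul V (unit k R) y ξ (one_mem_xgr k R)).symm
      rw [rho_unit, mul_one, mul_inv_cancel, R.gdeg_one, OneMemClass.coe_one, inv_one, one_mul,
        mul_one]
      rfl)

/-- The isomorphism `ξ ↦ 1 ⊗ ξ`. -/
noncomputable def leftUnit (V : D k R) : V ≅ (unit k R).tensor V :=
  isoOf (W := (unit k R).tensor V) (TensorProduct.lid k V).symm
    (fun x ξ h => by
      have := tmul_mem_xgr (one_mem_xgr k R) h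
      rw [LeftCosetReps.tdeg, mul_one, R.gdeg_inv_mul_repPart] at this
      exact this)
    (fun y => by
      refine lin_ext fun x ξ h => ?_
      refine Eq.trans ?_ (rho_tmul (unit k R) V y (one k R) h).symm
      rw [rho_unit]
      rfl)

theorem rightUnit_inv_tmul (V : D k R) (ξ : V) :
    linear (rightUnit V).inv (tmul ξ (one k R)) = ξ :=
  (TensorProduct.rid k V).apply_symm_apply ξ

theorem leftUnit_inv_tmul (V : D k R) (ξ : V) :
    linear (leftUnit V).inv (tmul (one k R) ξ) = ξ :=
  (TensorProduct.lid k V).apply_symm_apply ξ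

theorem associator_inv_tmul (U V W : D k R) {y z : X} (ξ : U) {η : V} {ζ : W}
    (hη : η ∈ V.data.xgr y) (hζ : ζ ∈ W.data.xgr z) :
    linear (associator U V W).inv (tmul ξ (tmul η ζ)) =
      tmul (tmul (U.rho (R.tau (R.repPart y) (R.repPart z)) ξ) η) ζ := by
  have h := associator_tmul U V W (U.rho (R.tau (R.repPart y) (R.repPart z)) ξ) hη hζ
  rw [rho_rho, inv_mul_cancel, map_one, Module.End.one_apply] at h
  rw [← h, ← linear_comp, Iso.hom_inv_id, linear_id]

theorem tensorHom_id_id (V W : D k R) : tensorHom (𝟙 V) (𝟙 W) = 𝟙 (V.tensor W) :=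
  hom_ext (tensor_ext fun _ _ _ _ _ _ => rfl)

theorem tensorHom_comp {V V' V'' W W' W'' : D k R} (f : V ⟶ V') (g : W ⟶ W') (f' : V' ⟶ V'')
    (g' : W' ⟶ W'') : tensorHom f g ≫ tensorHom f' g' = tensorHom (f ≫ f') (g ≫ g') :=
  hom_ext (tensor_ext fun _ _ _ _ _ _ => rfl)

theorem associator_naturality {U V W U' V' W' : D k R} (f : U ⟶ U') (g : V ⟶ V') (h : W ⟶ W') :
    tensorHom (tensorHom f g) h ≫ (associator U' V' W').hom =
      (associator U V W).hom ≫ tensorHom f (tensorHom g h) := by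
  refine hom_ext (tensor_ext₃ fun x y z ξ hξ η hη ζ hζ => ?_)
  rw [linear_comp, linear_comp, tensorHom_tmul, tensorHom_tmul, associator_tmul _ _ _ ξ hη hζ,
    associator_tmul _ _ _ _ (linear_mem g hη) (linear_mem h hζ), tensorHom_tmul, tensorHom_tmul,
    linear_rho]

theorem leftUnit_naturality {V W : D k R} (f : V ⟶ W) :
    tensorHom (𝟙 (unit k R)) f ≫ (leftUnit W).inv = (leftUnit V).inv ≫ f := by
  rw [Iso.comp_inv_eq, Category.assoc, Iso.eq_inv_comp]
  exact hom_ext rfl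

theorem rightUnit_naturality {V W : D k R} (f : V ⟶ W) :
    tensorHom f (𝟙 (unit k R)) ≫ (rightUnit W).inv = (rightUnit V).inv ≫ f := by
  rw [Iso.comp_inv_eq, Category.assoc, Iso.eq_inv_comp]
  exact hom_ext rfl

theorem pentagon (U V W Z : D k R) :
    tensorHom (associator U V W).hom (𝟙 Z) ≫ (associator U (V.tensor W) Z).hom ≫
        tensorHom (𝟙 U) (associator V W Z).hom =
      (associator (U.tensor V) W Z).hom ≫ (associator U V (W.tensor Z)).hom := by
  refine hom_ext (tensor_ext_left fun v ω hω => tensor_ext₃ fun x y z ξ hξ η hη ζ hζ => ?_)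
  simp only [LinearMap.comp_apply, LinearMap.flip_apply]
  rw [linear_comp, linear_comp, linear_comp, tensorHom_tmul, associator_tmul U V W ξ hη hζ,
    linear_id, associator_tmul U (V.tensor W) Z _ (tmul_mem_xgr hη hζ) hω,
    tensorHom_tmul, linear_id, associator_tmul V W Z η hζ hω,
    associator_tmul (U.tensor V) W Z _ hζ hω, rho_tmul U V _ _ hη,
    associator_tmul U V (W.tensor Z) _ (V.rho_mem _ hη) (tmul_mem_xgr hζ hω)]
  simp only [rho_rho, R.repPart_tdeg]
  exact congrArg (fun a => tmul (U.rho a ξ) _) (R.pentagon_rho _ _ y)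

theorem triangle (V W : D k R) :
    (associator V (unit k R) W).hom ≫ tensorHom (𝟙 V) (leftUnit W).inv =
      tensorHom (rightUnit V).inv (𝟙 W) := by
  refine hom_ext (tensor_ext_left fun v ζ hζ => tensor_ext fun x y ξ hξ c _ => ?_)
  obtain ⟨r, rfl⟩ := eq_smul_one c
  simp only [map_smul]
  congr 1
  simp only [LinearMap.comp_apply, LinearMap.flip_apply]
  rw [linear_comp, associator_tmul V (unit k R) W ξ (one_mem_xgr k R) hζ, tensorHom_tmul,
    tensorHom_tmul, rightUnit_inv_tmul, leftUnit_inv_tmul, linear_id, linear_id]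
  -- `τ(e,⟨ζ⟩) = 1`, so the associator does not move `ξ`.
  simp [R.coe_tau, R.repPart_one, R.coe_e, R.repPart_coe]

theorem braiding_naturality {V W V' W' : D k R} (f : V ⟶ V') (g : W ⟶ W') :
    tensorHom f g ≫ (braiding V' W').hom = (braiding V W).hom ≫ tensorHom g f := by
  refine hom_ext (tensor_ext fun x y ξ hξ η hη => ?_)
  rw [linear_comp, linear_comp, tensorHom_tmul, braiding_tmul _ _ hξ hη,
    braiding_tmul _ _ (linear_mem f hξ) (linear_mem g hη), tensorHom_tmul, linear_rho, linear_rho]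

theorem hexagon_forward (U V W : D k R) :
    (associator U V W).hom ≫ (braiding U (V.tensor W)).hom ≫ (associator V W U).hom =
      tensorHom (braiding U V).hom (𝟙 W) ≫ (associator V U W).hom ≫
        tensorHom (𝟙 V) (braiding U W).hom := by
  refine hom_ext (tensor_ext₃ fun x y z ξ hξ η hη ζ hζ => ?_)
  rw [linear_comp, linear_comp, linear_comp, linear_comp, tensorHom_tmul,
    associator_tmul _ _ _ _ hη hζ, linear_id,
    braiding_tmul _ (V.tensor W) (U.rho_mem _ hξ) (tmul_mem_xgr hη hζ), rho_tmul V W _ _ hζ,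
    associator_tmul V W U _ (W.rho_mem _ hζ) (U.rho_mem _ (U.rho_mem _ hξ)),
    braiding_tmul _ _ hξ hη, associator_tmul V U W _ (U.rho_mem _ hξ) hζ, tensorHom_tmul,
    linear_id, braiding_tmul _ _ (U.rho_mem _ hξ) hζ]
  simp only [rho_rho, R.repPart_conj, R.repPart_conj_mul, R.repPart_mul_tau_mul_gdeg]
  rw [R.hexagon_forward_rho, R.gdeg_tdeg]
  simp [mul_assoc]

theorem hexagon_reverse (U V W : D k R) :
    (associator U V W).inv ≫ (braiding (U.tensor V) W).hom ≫ (associator W U V).inv =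
      tensorHom (𝟙 U) (braiding V W).hom ≫ (associator U W V).inv ≫
        tensorHom (braiding U W).hom (𝟙 V) := by
  refine hom_ext (tensor_ext₃' fun x y z ξ hξ η hη ζ hζ => ?_)
  rw [linear_comp, linear_comp, linear_comp, linear_comp, tensorHom_tmul,
    associator_inv_tmul _ _ _ _ hη hζ, linear_id,
    braiding_tmul (U.tensor V) W (tmul_mem_xgr (U.rho_mem _ hξ) hη) hζ, rho_tmul U V _ _ hη,
    associator_inv_tmul W U V _ (U.rho_mem _ (U.rho_mem _ hξ)) (V.rho_mem _ hη),
    braiding_tmul _ _ hη hζ, associator_inv_tmul U W V _ (W.rho_mem _ hζ) (V.rho_mem _ hη),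
    tensorHom_tmul, linear_id, braiding_tmul _ _ (U.rho_mem _ hξ) (W.rho_mem _ hζ)]
  simp only [rho_rho, R.repPart_conj, R.hexagon_reverse_rho]
  rw [R.hexagon_reverse_rho']

end D

/-! ### Assembly of the braided category -/

namespace D

variable {X : Type w} [Group X] [Finite X] {G : Subgroup X} {k : Type u} [Field k]
  {R : LeftCosetReps G}

/-- The tensor product, unit and structure maps of `𝒟`. -/
@[reducible] noncomputable def monoidalStruct (k : Type u) [Field k] (R : LeftCosetReps G) :
    MonoidalCategoryStruct (D k R) where
  tensorObj := tensor
  whiskerLeft V _ _ φ := tensorHom (𝟙 V) φ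
  whiskerRight θ W := tensorHom θ (𝟙 W)
  tensorHom := tensorHom
  tensorUnit := unit k R
  associator := associator
  -- Unitors leave the tensor product, whereas the maps `l` and `r` enter it.
  leftUnitor V := (leftUnit V).symm
  rightUnitor V := (rightUnit V).symm

/-- The monoidal category `𝒟`. -/
@[reducible] noncomputable def monoidal (k : Type u) [Field k] (R : LeftCosetReps G) :
    MonoidalCategory (D k R) :=
  letI := monoidalStruct k R
  MonoidalCategory.ofTensorHom
    (id_tensorHom_id := tensorHom_id_id)
    (id_tensorHom := fun _ _ _ _ => rfl)
    (tensorHom_id := fun _ _ => rfl)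
    (tensorHom_comp_tensorHom := tensorHom_comp)
    (associator_naturality := associator_naturality)
    (leftUnitor_naturality := leftUnit_naturality)
    (rightUnitor_naturality := rightUnit_naturality)
    (pentagon := pentagon)
    (triangle := triangle)

/-- The braided category `𝒟`. -/
@[reducible] noncomputable def braided (k : Type u) [Field k] (R : LeftCosetReps G) :
    @BraidedCategory (D k R) _ (monoidal k R) :=
  letI := monoidal k R
  { braiding := braiding
    braiding_naturality_right := fun V _ _ f => braiding_naturality (𝟙 V) f
    braiding_naturality_left := fun f W => braiding_naturality f (𝟙 W)
    hexagon_forward := hexagon_forward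
    hexagon_reverse := hexagon_reverse }

end D

end CosetBraiding

theorem mainTheorem1 {X : Type w} [Group X] [Finite X] (G : Subgroup X) (R : LeftCosetReps G)
    (k : Type u) [Field k] :
    ∃ (hT : ∀ V W : D k R, (V.data.tensor W.data).IsObject) (hk : (Data.unit k R).IsObject),
      let T : D k R → D k R → D k R := fun V W => ⟨V.data.tensor W.data, hT V W⟩
      let I : D k R := ⟨Data.unit k R, hk⟩
      -- the gradings and actions of `V ⊗ W` on homogeneous elements
      (∀ (V W : D k R) (a b : R.M) (g h : G), ∀ ξ ∈ V.data.gr a g, ∀ η ∈ W.data.gr b h,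
        (ξ ⊗ₜ[k] η : T V W) ∈ (T V W).data.gr (R.dot a b) ((R.tau a b)⁻¹ * g * h) ∧
        (∀ u : G, (T V W).data.act u (ξ ⊗ₜ[k] η) =
          V.data.act (R.la b u) ξ ⊗ₜ[k] W.data.act u η) ∧
        (∀ (s c : R.M) (h' : G), W.data.mact (R.ra s g) η ∈ W.data.gr c h' →
          (T V W).data.mact (R.ra s (R.tau a b)) (ξ ⊗ₜ[k] η) =
            V.data.act (R.tau (R.ra s g) b * (R.tau c (R.ra s (g * h)))⁻¹) (V.data.mact s ξ)
              ⊗ₜ[k] W.data.mact (R.ra s g) η)) ∧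
      ∃ (tensorHom : ∀ {V V' W W' : D k R}, (V ⟶ V') → (W ⟶ W') → (T V W ⟶ T V' W'))
        (Φ : ∀ U V W : D k R, T (T U V) W ≅ T U (T V W))
        (l : ∀ V : D k R, V ≅ T V I)
        (r : ∀ V : D k R, V ≅ T I V)
        (Ψ : ∀ V W : D k R, T V W ≅ T W V),
        (∀ {V V' W W' : D k R} (θ : V ⟶ V') (φ : W ⟶ W') (ξ : V) (η : W),
          D.linear (tensorHom θ φ) (ξ ⊗ₜ[k] η) = D.linear θ ξ ⊗ₜ[k] D.linear φ η) ∧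
        (∀ (U V W : D k R) (b c : R.M) (h h' : G) (ξ : U),
          ∀ η ∈ V.data.gr b h, ∀ ζ ∈ W.data.gr c h',
          D.linear (Φ U V W).hom ((ξ ⊗ₜ[k] η) ⊗ₜ[k] ζ) =
            U.data.act (R.tau b c) ξ ⊗ₜ[k] (η ⊗ₜ[k] ζ)) ∧
        (∀ (V : D k R) (ξ : V), D.linear (l V).hom ξ = ξ ⊗ₜ[k] (1 : k)) ∧
        (∀ (V : D k R) (ξ : V), D.linear (r V).hom ξ = (1 : k) ⊗ₜ[k] ξ) ∧
        (∀ (V W : D k R) (a b : R.M) (g h : G), ∀ ξ ∈ V.data.gr a g, ∀ η ∈ W.data.gr b h,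
          D.linear (Ψ V W).hom (ξ ⊗ₜ[k] η) = W.data.mact a η ⊗ₜ[k] V.data.act h ξ) ∧
        -- with these structures, `𝒟` is a braided tensor category
        ∃ (m : MonoidalCategory (D k R)) (b : @BraidedCategory (D k R) _ m),
          @BraidedData.of (D k R) _ m b =
            { tensorObj := T
              whiskerLeft := fun V _ _ φ => tensorHom (𝟙 V) φ
              whiskerRight := fun θ W => tensorHom θ (𝟙 W)
              tensorHom := tensorHom
              tensorUnit := I
              associator := Φ
              leftUnitor := fun V => (r V).symm
              rightUnitor := fun V => (l V).symm
              braiding := Ψ } := by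
  -- `l` puts the unit on the right and `r` on the left, hence `rightUnit` comes before `leftUnit`.
  refine ⟨fun V W => (D.tensor V W).isObject, (D.unit k R).isObject, ?_, D.tensorHom,
    D.associator, D.rightUnit, D.leftUnit, D.braiding, fun _ _ _ _ => rfl, ?_, fun _ _ => rfl,
    fun _ _ => rfl, ?_, D.monoidal k R, D.braided k R, rfl⟩
  · intro V W a b g h ξ hξ η hη
    refine ⟨?_, fun u => Data.tensorAct_tmul V.data W.data u ξ hη,
      fun s c h' hc => Data.tensorMact_tmul V.data W.data s hξ hη hc⟩
    exact Data.mem_gr_of_mem_xgr (Data.tmul_mem_xgr (Data.mem_xgr_of_mem_gr hξ rfl)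
      (Data.mem_xgr_of_mem_gr hη rfl)) (R.tensorGrade_tdeg a b g h)
  · intro U V W b c h h' ξ η hη ζ hζ
    have := Data.assocLin_tmul U.data V.data W.data ξ (Data.mem_xgr_of_mem_gr hη rfl)
      (Data.mem_xgr_of_mem_gr hζ rfl)
    rw [R.repPart_inv_mul, R.repPart_inv_mul] at this
    exact this
  · intro V W a b g h ξ hξ η hη
    have := Data.braidLin_tmul V.data W.data (Data.mem_xgr_of_mem_gr hξ rfl)
      (Data.mem_xgr_of_mem_gr hη rfl)
    rw [R.repPart_inv_mul, R.gdeg_inv_mul] at this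
    exact this
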